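/- Let $B=(B_t)_{t\ge0}$ and $\tilde B=(\tilde B_t)_{t\ge 0}$ be independent Brownian motions on a probability space $(\Omega,\mathscr F,\mathbb P)$, let $(\alpha,\tilde\alpha)\in\mathbb R^2\setminus\{(0,0)\}$ and $W=\alpha B+\tilde\alpha\tilde B$. Let $X=(X_t)_{t\ge0}$ be a continuous Volterra process driven by $B$: a centered Gaussian process with continuous paths such that for every $T'>0$ one has $X_t=\int_0^{T'}K(t,s)\,dB_s$ for $t\in[0,T']$, with a square integrable kernel $K$ on $[0,T']^2$ satisfying $K(t,s)=0$ for $s>t$. Fix $T>0$, $n\in\mathbb N$, linearly independent $g_1,\dots,g_n\in L^2[0,T]$, and put $G_i=\int_0^T g_i(u)\,dW_u$ (Wiener integral) and $G=(G_1,\dots,G_n)$. For $x\in\mathbb R^n$ let $X^{g;x}$ be a process whose law is the regular conditional distribution of $X$ on $C[0,\infty)$ given $G=x$, taken in the version that is weakly continuous in $x$. Let $\gamma_\varepsilon>0$ ($\varepsilon>0$) with $\gamma_\varepsilon\to0$ as $\varepsilon\to0$. Assume that there are constants $M,\tau>0$ such that for all sufficiently small $\varepsilon>0$ $$\sup_{s,t\in[0,1],\,s\ne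 t}\frac{\operatorname{Var}(X_{T+\varepsilon t}-X_{T+\varepsilon s})}{\gamma_\varepsilon^2\,|t-s|^{2\tau}}\le M,$$ and that there are constants $\hat M,\hat\tau>0$ such that for all sufficiently small $\varepsilon>0$ and all $i=1,\dots,n$ $$\sup_{s,t\in[0,1],\,s\ne t}\frac{\bigl|\operatorname{Cov}\bigl(X_{T+\varepsilon t}-X_{T+\varepsilon s},\,G_i\bigr)\bigr|}{\gamma_\varepsilon\,|t-s|^{\hat\tau}}\le \hat M .$$ Then for every $x\in\mathbb R^n$ the family of processes $$U^\varepsilon_t=X^{g;x}_{T+\varepsilon t}-X^{g;x}_T-\mathbb E\bigl[X^{g;x}_{T+\varepsilon t}-X^{g;x}_T\bigr],\qquad t\in[0,1],\ \varepsilon>0,$$ is exponentially tight on $C[0,1]$ (with the uniform topology) at the inverse speed $\gamma_\varepsilon^2$: for every $R>0$ there is a compact set $K_R\subset C[0,1]$ with $$\limsup_{\varepsilon\to0}\gamma_\varepsilon^2\log\mathbb P(U^\varepsilon\notin K_R)\le -R .$$ -/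

import Mathlib

open MeasureTheory ProbabilityTheory Filter Topology Set
open scoped NNReal ENNReal BoundedContinuousFunction

/-- The path space `C[0, ∞)` carries the topology of uniform convergence on compact sets (the
compact-open topology of Mathlib) and its Borel σ-algebra. -/
instance instMeasurableSpacePathSpace : MeasurableSpace C(ℝ≥0, ℝ) := borel _

instance instBorelSpacePathSpace : BorelSpace C(ℝ≥0, ℝ) := ⟨rfl⟩

/-- A step function `∑ i, c i • 1_{(a i, b i]}` on `[0, T]`. -/
structure StepFn (T : ℝ≥0) where
  m : ℕ
  c : Fin m → ℝ
  a : Fin m → ℝ≥0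
  b : Fin m → ℝ≥0
  a_le_b : ∀ i, a i ≤ b i
  b_le_T : ∀ i, b i ≤ T

/-- The function on the line represented by a step function. -/
noncomputable def StepFn.toFun {T : ℝ≥0} (φ : StepFn T) (u : ℝ) : ℝ :=
  ∑ i, φ.c i * (Ioc (φ.a i : ℝ) (φ.b i : ℝ)).indicator (fun _ => (1 : ℝ)) u

/-- The elementary integral `∑ i, c i * (W (b i) - W (a i))` of a step function. -/
noncomputable def StepFn.stochInt {Ω : Type*} {T : ℝ≥0} (φ : StepFn T) (W : ℝ≥0 → Ω → ℝ)
    (ω : Ω) : ℝ :=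
  ∑ i, φ.c i * (W (φ.b i) ω - W (φ.a i) ω)

/-- `Y` is (a version of) the Wiener integral `∫₀ᵀ f(u) dW_u` of the deterministic function
`f ∈ L²[0, T]`: it is the `L²(P)`-limit of the elementary integrals of step functions that converge
to `f` in `L²[0, T]`. -/
structure IsWienerIntegral {Ω : Type*} [MeasurableSpace Ω] (W : ℝ≥0 → Ω → ℝ) (P : Measure Ω)
    (T : ℝ≥0) (f : ℝ → ℝ) (Y : Ω → ℝ) : Prop where
  memLp_integrand : MemLp f 2 (volume.restrict (Icc (0 : ℝ) T))
  memLp_integral : MemLp Y 2 P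
  exists_approx : ∃ φ : ℕ → StepFn T,
    Tendsto (fun N => eLpNorm (fun u => (φ N).toFun u - f u) 2 (volume.restrict (Icc (0 : ℝ) T)))
      atTop (𝓝 0) ∧
    Tendsto (fun N => eLpNorm (fun ω => (φ N).stochInt W ω - Y ω) 2 P) atTop (𝓝 0)

/-- `X` is a Volterra process driven by the Brownian motion `B`: a centered Gaussian process such
that, for every `T > 0`, `X_t = ∫₀ᵀ K(t, s) dB_s` for `t ∈ [0, T]`, with a square integrable kernel
`K` on `[0, T]²` that vanishes for `s > t`. -/
structure IsVolterraProcess {Ω : Type*} [MeasurableSpace Ω] (X : ℝ≥0 → Ω → ℝ) (B : ℝ≥0 → Ω → ℝ)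
    (P : Measure Ω) : Prop where
  gaussian : IsGaussianProcess X P
  centered : ∀ t, ∫ ω, X t ω ∂P = 0
  exists_kernel : ∀ T : ℝ≥0, 0 < T → ∃ K : ℝ → ℝ → ℝ,
    MemLp (fun p : ℝ × ℝ => K p.1 p.2) 2
      ((volume.restrict (Icc (0 : ℝ) T)).prod (volume.restrict (Icc (0 : ℝ) T))) ∧
    (∀ t ∈ Icc (0 : ℝ) T, ∀ s ∈ Icc (0 : ℝ) T, t < s → K t s = 0) ∧
    ∀ t : ℝ≥0, t ≤ T → IsWienerIntegral B P T (K t) (X t)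

/-- The mixed Brownian motion `W^{α, α'} = α B + α' B'`. -/
def mixedBM {Ω : Type*} (α α' : ℝ) (B B' : ℝ≥0 → Ω → ℝ) (t : ℝ≥0) (ω : Ω) : ℝ :=
  α * B t ω + α' * B' t ω

/-- `κ x`, for `x ∈ ℝⁿ`, is the regular conditional distribution on `C[0, ∞)` of the continuous
process `X` given `G = x`. A regular conditional distribution is only determined for almost every
`x`; the version meant here is the one that is weakly continuous in `x`
(the continuous disintegration), which makes `κ x` meaningful for each single `x`. -/
structure IsConditionedLaw {Ω : Type*} [MeasurableSpace Ω] {n : ℕ} (X : Ω → C(ℝ≥0, ℝ))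
    (G : Fin n → Ω → ℝ) (P : Measure Ω) (κ : Kernel (Fin n → ℝ) C(ℝ≥0, ℝ)) : Prop where
  markov : IsMarkovKernel κ
  hasCondDistrib : HasCondDistrib X (fun ω i => G i ω) κ P
  weakly_continuous : ∀ F : C(ℝ≥0, ℝ) →ᵇ ℝ, Continuous fun x => ∫ f, F f ∂(κ x)

/-- The time `T + ε t`, for `t ∈ [0, 1]`. -/
noncomputable def zoomTime (T ε : ℝ≥0) (t : unitInterval) : ℝ≥0 :=
  T + ε * unitInterval.toNNReal t

/-- For a process with law `μ` on `C[0, ∞)` (realized as the coordinate process `f ↦ f t`), the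
centered increment `X_{T + ε t} - X_T - E[X_{T + ε t} - X_T]`, for `t ∈ [0, 1]`. -/
noncomputable def centeredIncrement (μ : Measure C(ℝ≥0, ℝ)) (T ε : ℝ≥0) (t : unitInterval)
    (f : C(ℝ≥0, ℝ)) : ℝ :=
  f (zoomTime T ε t) - f T - ∫ h, (h (zoomTime T ε t) - h T) ∂μ

/-- The family `((U^ε_t)_{t ∈ [0, 1]})_{ε > 0}` of processes on the probability space `(Ω, P)` is
exponentially tight on `C[0, 1]` (with the uniform topology) at the inverse speed `η`: for every
`R > 0` there is a compact `K ⊆ C[0, 1]` with `limsup_{ε → 0} η_ε log P(U^ε ∉ K) ≤ -R`, where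
`log 0 = -∞`. A path that is not continuous counts as lying outside `K`. -/
def IsExponentiallyTight {Ω : Type*} [MeasurableSpace Ω] (P : Measure Ω)
    (U : ℝ≥0 → unitInterval → Ω → ℝ) (η : ℝ≥0 → ℝ) : Prop :=
  ∀ R : ℝ, 0 < R → ∃ K : Set C(unitInterval, ℝ), IsCompact K ∧
    limsup (fun ε : ℝ≥0 =>
        ((η ε : ℝ) : EReal) * ENNReal.log (P {ω | ¬ ∃ k ∈ K, ∀ t, k t = U ε t ω}))
      (𝓝[>] 0) ≤ ((-R : ℝ) : EReal)

/-! Conditioning a Gaussian process on finitely many Gaussian variables shifts its mean and does not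
increase the variance of any increment; centering removes the shift. So the centered conditioned
increments are centered Gaussian with the same bound `M γ² |t - s| ^ (2τ)` as the unconditioned
ones, and exponential tightness becomes a Gaussian chaining estimate.

Conditioning: `X` and `G` are `L²`-limits of combinations of `B` and `B'`, so they lie in one
Gaussian Hilbert space and are jointly Gaussian. By the Itô isometry the covariance matrix of `G` is
`α² + α'²` times the Gram matrix of the `g i`, hence positive definite. An increment `D` of `X`
splits as `a ⬝ᵥ G + Z` with `Z` independent of `G`, so its conditional law is `N(a ⬝ᵥ x, Var Z)`
with `Var Z ≤ Var D`. This is known only for almost every `x`; since `G` has full support and `κ` is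
weakly continuous, it holds for every `x` (`exists_map_increment_eq_gaussianReal`).

Chaining: a path leaves the compact set only if some dyadic increment of level `k` exceeds `A r ^
k`. With `r = 2 ^ (-τ/2)` the threshold decays more slowly than the standard deviation `~ r ^ (2k)`,
so the Gaussian tails beat the `2 ^ k` increments of each level and the total is at most `4 exp (-R
/ γ²)`, with a compact set independent of `ε` (`isExponentiallyTight_of_gaussian_increments`).

The covariance bound serves only to make the subtracted conditional mean continuous in `t`. -/

/-! ### Compact sets of paths with a geometric modulus of continuity -/

/-- Continuous functions on `[0, 1]` that vanish at `0` and oscillate by at most `C * r ^ k` on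
scale `2 ^ (-k)`. -/
def geometricModulusSet (C r : ℝ) : Set C(unitInterval, ℝ) :=
  {f | f 0 = 0 ∧ ∀ (k : ℕ) (s t : unitInterval), |(t : ℝ) - s| ≤ (1 / 2 : ℝ) ^ k →
    |f t - f s| ≤ C * r ^ k}

lemma exists_modulus_scale {C r : ℝ} (hr0 : 0 ≤ r) (hr1 : r < 1) {ε : ℝ} (hε : 0 < ε) :
    ∃ k : ℕ, C * r ^ k < ε := by
  have h : Tendsto (fun k : ℕ => C * r ^ k) atTop (𝓝 0) := by
    simpa using (tendsto_pow_atTop_nhds_zero_of_lt_one hr0 hr1).const_mul C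
  exact (h.eventually (gt_mem_nhds hε)).exists

/-- Arzelà–Ascoli: the modulus gives equicontinuity, and `k = 0` with `f 0 = 0` bounds the paths by
`C`. The modulus conditions survive pointwise limits and themselves force continuity, so the set is
closed in the compact cube of all functions. -/
lemma isCompact_geometricModulusSet {C r : ℝ} (hr0 : 0 ≤ r) (hr1 : r < 1) :
    IsCompact (geometricModulusSet C r) := by
  apply ArzelaAscoli.isCompact_of_equicontinuous
  · have himage : ContinuousMap.toFun '' geometricModulusSet C r =
        {h : unitInterval → ℝ | h 0 = 0 ∧ ∀ (k : ℕ) (s t : unitInterval),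
          |(t : ℝ) - s| ≤ (1 / 2 : ℝ) ^ k → |h t - h s| ≤ C * r ^ k} := by
      ext h
      constructor
      · rintro ⟨f, hf, rfl⟩
        exact hf
      · intro hh
        refine ⟨⟨h, ?_⟩, hh, rfl⟩
        rw [Metric.continuous_iff]
        intro s ε hε
        obtain ⟨k, hk⟩ := exists_modulus_scale (C := C) hr0 hr1 hε
        refine ⟨(1 / 2 : ℝ) ^ k, by positivity, fun t ht => ?_⟩
        rw [Subtype.dist_eq, Real.dist_eq] at ht
        rw [Real.dist_eq]
        exact (hh.2 k s t ht.le).trans_lt hk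
    rw [himage]
    refine IsCompact.of_isClosed_subset
      (isCompact_univ_pi fun _ : unitInterval => isCompact_Icc (a := -C) (b := C)) ?_ ?_
    · simp only [ofPred_and, ofPred_forall]
      refine IsClosed.inter (isClosed_eq (continuous_apply _) continuous_const) ?_
      refine isClosed_iInter fun k => isClosed_iInter fun s => isClosed_iInter fun t =>
        isClosed_iInter fun _ => isClosed_le ?_ continuous_const
      exact ((continuous_apply t).sub (continuous_apply s)).abs
    · rintro h ⟨h0, hh⟩ t -
      have := hh 0 0 t (by simpa [abs_le] using ⟨by linarith [t.2.1], t.2.2⟩)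
      rw [h0] at this
      simpa [abs_le] using this
  · apply UniformEquicontinuous.equicontinuous
    rw [Metric.uniformEquicontinuous_iff]
    intro ε hε
    obtain ⟨k, hk⟩ := exists_modulus_scale (C := C) hr0 hr1 hε
    refine ⟨(1 / 2 : ℝ) ^ k, by positivity, fun s t hst f => ?_⟩
    rw [Subtype.dist_eq, Real.dist_eq, abs_sub_comm] at hst
    rw [dist_comm, Real.dist_eq]
    exact (f.2.2 k s t hst.le).trans_lt hk

/-! ### Dyadic chaining -/

/-- The dyadic point `j / 2 ^ k` of `[0, 1]`. -/
noncomputable def dyadicPoint (k j : ℕ) : unitInterval :=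
  projIcc 0 1 zero_le_one ((j : ℝ) / 2 ^ k)

lemma coe_dyadicPoint {k j : ℕ} (h : j ≤ 2 ^ k) : (dyadicPoint k j : ℝ) = j / 2 ^ k := by
  have h' : (j : ℝ) ≤ 2 ^ k := by exact_mod_cast h
  rw [dyadicPoint, projIcc_of_mem zero_le_one ⟨by positivity, by
    rw [div_le_one (by positivity)]; exact h'⟩]

lemma dyadicPoint_succ_two_mul (k j : ℕ) : dyadicPoint (k + 1) (2 * j) = dyadicPoint k j := by
  unfold dyadicPoint
  congr 1
  push_cast
  rw [pow_succ]
  field_simp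

/-- The largest dyadic point of level `k` below `t`. -/
noncomputable def dyadicFloor (k : ℕ) (t : unitInterval) : unitInterval :=
  dyadicPoint k ⌊(2 : ℝ) ^ k * t⌋₊

lemma floor_two_pow_mul_le (k : ℕ) (t : unitInterval) : ⌊(2 : ℝ) ^ k * t⌋₊ ≤ 2 ^ k := by
  have h2 : (0 : ℝ) < 2 ^ k := by positivity
  have : (2 : ℝ) ^ k * t ≤ ((2 ^ k : ℕ) : ℝ) := by
    push_cast
    nlinarith [t.2.2]
  exact (Nat.floor_le_floor this).trans (Nat.floor_natCast _).le

lemma tendsto_dyadicFloor (t : unitInterval) :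
    Tendsto (fun k => dyadicFloor k t) atTop (𝓝 t) := by
  rw [tendsto_subtype_rng]
  simp only [dyadicFloor, coe_dyadicPoint (floor_two_pow_mul_le _ _)]
  have h0 : Tendsto (fun k : ℕ => (t : ℝ) - (1 / 2 : ℝ) ^ k) atTop (𝓝 t) := by
    simpa using tendsto_const_nhds.sub
      (tendsto_pow_atTop_nhds_zero_of_lt_one (by norm_num : (0 : ℝ) ≤ 1 / 2) (by norm_num))
  refine tendsto_of_tendsto_of_tendsto_of_le_of_le h0 tendsto_const_nhds (fun k => ?_) fun k => ?_
  · have h2 : (0 : ℝ) < 2 ^ k := by positivity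
    have := Nat.lt_floor_add_one ((2 : ℝ) ^ k * t)
    simp only [one_div, inv_pow]
    rw [le_div_iff₀ h2, sub_mul, inv_mul_cancel₀ h2.ne']
    linarith
  · have h2 : (0 : ℝ) < 2 ^ k := by positivity
    have := Nat.floor_le (a := (2 : ℝ) ^ k * t) (mul_nonneg h2.le t.2.1)
    simp only
    rw [div_le_iff₀ h2]
    linarith

/-- Chaining: `t` and `s` are each joined to their level-`k` floors by a geometric series costing `A
r ^ k / (1 - r)`, and when `|t - s| ≤ 2 ^ (-k)` the two floors are equal or adjacent, costing at
most `A r ^ k` more. -/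
lemma mem_geometricModulusSet_of_dyadic {A r : ℝ} (hA : 0 ≤ A) (hr0 : 0 ≤ r) (hr1 : r < 1)
    {f : C(unitInterval, ℝ)} (hf0 : f 0 = 0)
    (hf : ∀ k j : ℕ, j < 2 ^ k → |f (dyadicPoint k (j + 1)) - f (dyadicPoint k j)| ≤ A * r ^ k) :
    f ∈ geometricModulusSet (A + 2 * (A / (1 - r))) r := by
  have hstep : ∀ (t : unitInterval) (k : ℕ),
      dist (f (dyadicFloor k t)) (f (dyadicFloor (k + 1) t)) ≤ A * r ^ k := by
    intro t k
    have hpow : A * r ^ (k + 1) ≤ A * r ^ k :=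
      mul_le_mul_of_nonneg_left (pow_le_pow_of_le_one hr0 hr1.le (Nat.le_succ k)) hA
    set a := (2 : ℝ) ^ k * t with ha
    have ha0 : 0 ≤ a := mul_nonneg (by positivity) t.2.1
    have hb : (2 : ℝ) ^ (k + 1) * t = 2 * a := by rw [ha]; ring
    have h1 := Nat.floor_le ha0
    have h2 := Nat.lt_floor_add_one a
    have hlow : 2 * ⌊a⌋₊ ≤ ⌊2 * a⌋₊ := by
      apply Nat.le_floor
      push_cast
      linarith
    have hup : ⌊2 * a⌋₊ < 2 * ⌊a⌋₊ + 2 := by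
      rw [Nat.floor_lt (by linarith)]
      push_cast
      linarith
    have hle : ⌊2 * a⌋₊ ≤ 2 ^ (k + 1) := by
      rw [← hb]
      exact floor_two_pow_mul_le _ _
    simp only [dyadicFloor]
    rw [hb, ← ha, ← dyadicPoint_succ_two_mul, dist_comm, Real.dist_eq]
    -- Refining the floor by one level either keeps the point or moves it by one mesh step of level
    -- `k + 1`.
    rcases (by omega : ⌊2 * a⌋₊ = 2 * ⌊a⌋₊ ∨ ⌊2 * a⌋₊ = 2 * ⌊a⌋₊ + 1) with h | h
    · rw [h]
      simpa using by positivity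
    · rw [h]
      exact (hf _ _ (by omega)).trans hpow
  have hfloor : ∀ (t : unitInterval) (k : ℕ),
      |f (dyadicFloor k t) - f t| ≤ A * r ^ k / (1 - r) := fun t k =>
    dist_le_of_le_geometric_of_tendsto r A hr1 (hstep t)
      ((f.continuous.tendsto t).comp (tendsto_dyadicFloor t)) k
  have hadj : ∀ (k : ℕ) (s t : unitInterval), (s : ℝ) ≤ t → (t : ℝ) - s ≤ (1 / 2 : ℝ) ^ k →
      |f (dyadicFloor k t) - f (dyadicFloor k s)| ≤ A * r ^ k := by
    intro k s t hst h
    have h2 : (0 : ℝ) < 2 ^ k := by positivity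
    have hts : (2 : ℝ) ^ k * t ≤ 2 ^ k * s + 1 := by
      have := mul_le_mul_of_nonneg_left h h2.le
      rw [← mul_pow] at this
      norm_num at this
      linarith
    have hlow : ⌊(2 : ℝ) ^ k * s⌋₊ ≤ ⌊(2 : ℝ) ^ k * t⌋₊ :=
      Nat.floor_le_floor (mul_le_mul_of_nonneg_left hst h2.le)
    have hup : ⌊(2 : ℝ) ^ k * t⌋₊ ≤ ⌊(2 : ℝ) ^ k * s⌋₊ + 1 := by
      rw [← Nat.floor_add_one (mul_nonneg h2.le s.2.1)]
      exact Nat.floor_le_floor hts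
    have hle := floor_two_pow_mul_le k t
    simp only [dyadicFloor]
    rcases (by omega : ⌊(2 : ℝ) ^ k * t⌋₊ = ⌊(2 : ℝ) ^ k * s⌋₊ ∨
      ⌊(2 : ℝ) ^ k * t⌋₊ = ⌊(2 : ℝ) ^ k * s⌋₊ + 1) with h | h
    · rw [h]
      simpa using by positivity
    · rw [h]
      exact hf _ _ (by omega)
  have hmod : ∀ (k : ℕ) (s t : unitInterval), (s : ℝ) ≤ t → (t : ℝ) - s ≤ (1 / 2 : ℝ) ^ k →
      |f t - f s| ≤ (A + 2 * (A / (1 - r))) * r ^ k := by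
    intro k s t hst h
    have e1 := abs_le.1 (hfloor t k)
    have e2 := abs_le.1 (hfloor s k)
    have e3 := abs_le.1 (hadj k s t hst h)
    have e4 : (A + 2 * (A / (1 - r))) * r ^ k = A * r ^ k + 2 * (A * r ^ k / (1 - r)) := by ring
    rw [e4, abs_le]
    constructor <;> linarith [e1.1, e1.2, e2.1, e2.2, e3.1, e3.2]
  refine ⟨hf0, fun k s t h => ?_⟩
  rcases le_total (s : ℝ) t with hst | hst
  · exact hmod k s t hst (by rwa [abs_of_nonneg (sub_nonneg.2 hst)] at h)
  · rw [abs_sub_comm] at h ⊢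
    exact hmod k t s hst (by rwa [abs_of_nonneg (sub_nonneg.2 hst)] at h)

/-! ### Exponential tightness of Gaussian processes -/

/-- Chernoff bound for `X` and `-X`. Taking the upper bound `c` rather than `w` as variance proxy
also covers the degenerate case `w = 0`. -/
lemma measure_lt_abs_le_of_map_eq_gaussianReal {Ω : Type*} [MeasurableSpace Ω] {μ : Measure Ω}
    {X : Ω → ℝ} {w : ℝ≥0} (hX : μ.map X = gaussianReal 0 w) {c a : ℝ} (hc : 0 < c)
    (hw : (w : ℝ) ≤ c) (ha : 0 ≤ a) :
    μ {ω | a < |X ω|} ≤ ENNReal.ofReal (2 * Real.exp (-a ^ 2 / (2 * c))) := by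
  have hXm : AEMeasurable X μ := aemeasurable_of_map_neZero (by rw [hX]; infer_instance)
  have : IsProbabilityMeasure μ := by
    have : IsProbabilityMeasure (μ.map X) := by rw [hX]; infer_instance
    exact μ.isProbabilityMeasure_of_map X
  have hsub : ∀ {Z : Ω → ℝ}, AEMeasurable Z μ → μ.map Z = gaussianReal 0 w →
      HasSubgaussianMGF Z c.toNNReal μ := by
    intro Z hZm hZ
    constructor
    · intro t
      have h := integrable_exp_mul_gaussianReal (μ := 0) (v := w) t
      rw [← hZ] at h
      exact h.comp_aemeasurable hZm
    · intro t
      rw [mgf_gaussianReal hZ, Real.coe_toNNReal _ hc.le, zero_mul, zero_add]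
      gcongr
  have hneg : μ.map (fun ω => -X ω) = gaussianReal 0 w := by
    have h := (gaussianReal_neg ⟨hXm, hX⟩).map_eq
    rwa [neg_zero] at h
  have h1 := (hsub hXm hX).measure_ge_le ha
  have h2 := (hsub hXm.neg hneg).measure_ge_le ha
  rw [Real.coe_toNNReal _ hc.le] at h1 h2
  calc μ {ω | a < |X ω|} ≤ μ ({ω | a ≤ X ω} ∪ {ω | a ≤ -X ω}) :=
        measure_mono fun ω hω => (lt_abs.1 (show a < |X ω| from hω)).imp (fun h => h.le) fun h => h.le
    _ ≤ μ {ω | a ≤ X ω} + μ {ω | a ≤ -X ω} := measure_union_le _ _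
    _ = ENNReal.ofReal (μ.real {ω | a ≤ X ω} + μ.real {ω | a ≤ -X ω}) := by
        rw [ENNReal.ofReal_add measureReal_nonneg measureReal_nonneg, ofReal_measureReal,
          ofReal_measureReal]
    _ ≤ _ := ENNReal.ofReal_le_ofReal (by rw [two_mul]; exact add_le_add h1 h2)

/-- Union bound over all dyadic increments. With `L = A ^ 2 / (2 * v)` the level-`k` exponent is `-L
r ^ (-2k)`, which Bernoulli's inequality bounds by `-L - k L (r ^ (-2) - 1)`; `hsmall` turns the
last term into a factor `4 ^ (-k)`, which absorbs the `2 ^ k` increments. -/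
lemma measure_notMem_geometricModulusSet_le {Ω : Type*} [MeasurableSpace Ω] {μ : Measure Ω}
    {Y : unitInterval → Ω → ℝ} (h0 : ∀ ω, Y 0 ω = 0) (hcont : ∀ ω, Continuous fun t => Y t ω)
    {A r v : ℝ} (hA : 0 ≤ A) (hr0 : 0 < r) (hr1 : r < 1) (hv : 0 < v)
    (htail : ∀ k j : ℕ, j < 2 ^ k →
      μ {ω | A * r ^ k < |Y (dyadicPoint k (j + 1)) ω - Y (dyadicPoint k j) ω|} ≤
        ENNReal.ofReal (2 * Real.exp (-(A * r ^ k) ^ 2 / (2 * (v * (r ^ k) ^ 4)))))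
    (hsmall : Real.exp (-(A ^ 2 / (2 * v)) * (r⁻¹ ^ 2 - 1)) ≤ 1 / 4) :
    μ {ω | ¬ ∃ f ∈ geometricModulusSet (A + 2 * (A / (1 - r))) r, ∀ t, f t = Y t ω} ≤
      ENNReal.ofReal (4 * Real.exp (-(A ^ 2 / (2 * v)))) := by
  set L := A ^ 2 / (2 * v) with hL
  have hL0 : 0 ≤ L := by positivity
  have hsub : {ω | ¬ ∃ f ∈ geometricModulusSet (A + 2 * (A / (1 - r))) r, ∀ t, f t = Y t ω} ⊆
      ⋃ k : ℕ, ⋃ j ∈ Finset.range (2 ^ k),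
        {ω | A * r ^ k < |Y (dyadicPoint k (j + 1)) ω - Y (dyadicPoint k j) ω|} := by
    intro ω hω
    by_contra hcon
    simp only [mem_iUnion, Finset.mem_range, mem_ofPred_eq, not_exists, not_lt] at hcon
    exact hω ⟨⟨fun t => Y t ω, hcont ω⟩,
      mem_geometricModulusSet_of_dyadic hA hr0.le hr1 (h0 ω) fun k j hj => hcon k j hj,
      fun t => rfl⟩
  have hterm : ∀ k : ℕ, (2 : ℝ) ^ k *
      (2 * Real.exp (-(A * r ^ k) ^ 2 / (2 * (v * (r ^ k) ^ 4)))) ≤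
        2 * Real.exp (-L) * (1 / 2 : ℝ) ^ k := by
    intro k
    have hexp : -(A * r ^ k) ^ 2 / (2 * (v * (r ^ k) ^ 4)) = -L * (r⁻¹ ^ 2) ^ k := by
      have hrk : (r⁻¹ ^ 2) ^ k = ((r ^ k) ^ 2)⁻¹ := by
        rw [← pow_mul, mul_comm 2 k, pow_mul, inv_pow, inv_pow]
      have : 0 < r ^ k := pow_pos hr0 k
      rw [hL, hrk]
      field_simp
    have hbern : 1 + (k : ℝ) * (r⁻¹ ^ 2 - 1) ≤ (r⁻¹ ^ 2) ^ k := by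
      have h := one_add_mul_le_pow (a := r⁻¹ ^ 2 - 1) (by nlinarith [sq_nonneg r⁻¹]) k
      simpa using h
    have hle : Real.exp (-L * (r⁻¹ ^ 2) ^ k) ≤ Real.exp (-L) * (1 / 4 : ℝ) ^ k := by
      calc Real.exp (-L * (r⁻¹ ^ 2) ^ k) ≤ Real.exp (-L + k * (-L * (r⁻¹ ^ 2 - 1))) := by
            apply Real.exp_le_exp.2
            nlinarith
        _ = Real.exp (-L) * Real.exp (-L * (r⁻¹ ^ 2 - 1)) ^ k := by
            rw [Real.exp_add, Real.exp_nat_mul]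
        _ ≤ _ := by gcongr
    rw [hexp]
    calc (2 : ℝ) ^ k * (2 * Real.exp (-L * (r⁻¹ ^ 2) ^ k))
        ≤ 2 ^ k * (2 * (Real.exp (-L) * (1 / 4 : ℝ) ^ k)) := by gcongr
      _ = 2 * Real.exp (-L) * (2 * (1 / 4)) ^ k := by rw [mul_pow]; ring
      _ = _ := by norm_num
  have hsum : HasSum (fun k : ℕ => 2 * Real.exp (-L) * (1 / 2 : ℝ) ^ k) (4 * Real.exp (-L)) := by
    have h := hasSum_geometric_two.mul_left (2 * Real.exp (-L))
    rwa [mul_right_comm, show (2 : ℝ) * 2 = 4 by norm_num] at h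
  calc _ ≤ _ := measure_mono hsub
    _ ≤ ∑' k : ℕ, μ (⋃ j ∈ Finset.range (2 ^ k),
        {ω | A * r ^ k < |Y (dyadicPoint k (j + 1)) ω - Y (dyadicPoint k j) ω|}) :=
        measure_iUnion_le _
    _ ≤ ∑' k : ℕ, ENNReal.ofReal (2 * Real.exp (-L) * (1 / 2 : ℝ) ^ k) := by
        refine ENNReal.tsum_le_tsum fun k => ?_
        refine (measure_biUnion_finset_le _ _).trans ?_
        refine (Finset.sum_le_sum fun j hj => htail k j (Finset.mem_range.1 hj)).trans ?_
        rw [Finset.sum_const, Finset.card_range, nsmul_eq_mul]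
        refine le_trans (le_of_eq ?_) (ENNReal.ofReal_le_ofReal (hterm k))
        rw [ENNReal.ofReal_mul (by positivity : (0 : ℝ) ≤ 2 ^ k), ENNReal.ofReal_pow (by norm_num)]
        simp
    _ = _ := by
        rw [← ENNReal.ofReal_tsum_of_nonneg (fun k => by positivity) hsum.summable, hsum.tsum_eq]

/-- A family of continuous processes started at `0` whose increments are centered Gaussian with
variance at most `M γ_ε² |t - s| ^ (2 τ)` is exponentially tight at the inverse speed `γ_ε²`. -/
theorem isExponentiallyTight_of_gaussian_increments {Ω : Type*} [MeasurableSpace Ω]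
    {μ : Measure Ω} {U : ℝ≥0 → unitInterval → Ω → ℝ} {γ : ℝ≥0 → ℝ}
    (hγ_pos : ∀ ε, 0 < ε → 0 < γ ε) (hγ : Tendsto γ (𝓝[>] 0) (𝓝 0)) {M τ : ℝ} (hM : 0 < M)
    (hτ : 0 < τ)
    (hU0 : ∀ ε ω, U ε 0 ω = 0)
    (hUcont : ∀ᶠ ε in 𝓝[>] (0 : ℝ≥0), ∀ ω, Continuous fun t => U ε t ω)
    (hUgauss : ∀ᶠ ε in 𝓝[>] (0 : ℝ≥0), ∀ s t : unitInterval, s ≠ t → ∃ w : ℝ≥0,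
      μ.map (fun ω => U ε t ω - U ε s ω) = gaussianReal 0 w ∧
        (w : ℝ) ≤ M * γ ε ^ 2 * |(t : ℝ) - s| ^ (2 * τ)) :
    IsExponentiallyTight μ U fun ε => γ ε ^ 2 := by
  intro R hR
  -- At distance `2 ^ (-k)` the factor `|t - s| ^ (2τ)` equals `(r ^ k) ^ 4`.
  set r : ℝ := (1 / 2 : ℝ) ^ (τ / 2) with hr
  have hr0 : 0 < r := by positivity
  have hr1 : r < 1 := Real.rpow_lt_one (by norm_num) (by norm_num) (by positivity)
  -- Chosen so that `A ^ 2 / (2 * (M * γ ε ^ 2)) = R / γ ε ^ 2`.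
  set A : ℝ := √(2 * M * R) with hA
  have hA2 : A ^ 2 = 2 * M * R := Real.sq_sqrt (by positivity)
  refine ⟨geometricModulusSet (A + 2 * (A / (1 - r))) r,
    isCompact_geometricModulusSet hr0.le hr1, ?_⟩
  have hpos : ∀ᶠ ε in 𝓝[>] (0 : ℝ≥0), 0 < γ ε := by
    filter_upwards [self_mem_nhdsWithin] with ε hε using hγ_pos ε hε
  have hγ2 : Tendsto (fun ε => γ ε ^ 2) (𝓝[>] 0) (𝓝 0) := by simpa using hγ.pow 2
  have hq : 0 < r⁻¹ ^ 2 - 1 := by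
    have := one_lt_inv₀ hr0 |>.2 hr1
    nlinarith
  have hsmall : ∀ᶠ ε in 𝓝[>] (0 : ℝ≥0),
      Real.exp (-(R / γ ε ^ 2) * (r⁻¹ ^ 2 - 1)) ≤ 1 / 4 := by
    have h1 : Tendsto (fun ε => (γ ε ^ 2)⁻¹) (𝓝[>] 0) atTop :=
      tendsto_inv_nhdsGT_zero.comp (tendsto_nhdsWithin_iff.2
        ⟨hγ2, hpos.mono fun ε h => by simpa using pow_pos h 2⟩)
    have h2 : Tendsto (fun ε => Real.exp (-((R * (r⁻¹ ^ 2 - 1)) * (γ ε ^ 2)⁻¹)))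
        (𝓝[>] 0) (𝓝 0) :=
      Real.tendsto_exp_neg_atTop_nhds_zero.comp (h1.const_mul_atTop (mul_pos hR hq))
    filter_upwards [h2.eventually (ge_mem_nhds (by norm_num : (0 : ℝ) < 1 / 4))] with ε hε
    rwa [mul_right_comm, ← neg_mul, ← div_eq_mul_inv] at hε
  have hbound : ∀ᶠ ε in 𝓝[>] (0 : ℝ≥0), ((γ ε ^ 2 : ℝ) : EReal) * ENNReal.log
      (μ {ω | ¬ ∃ k ∈ geometricModulusSet (A + 2 * (A / (1 - r))) r, ∀ t, k t = U ε t ω}) ≤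
        ((γ ε ^ 2 * Real.log 4 - R : ℝ) : EReal) := by
    filter_upwards [hpos, hsmall, hUcont, hUgauss] with ε hpos hsmall hcont hgauss
    have hL : A ^ 2 / (2 * (M * γ ε ^ 2)) = R / γ ε ^ 2 := by
      rw [hA2]
      field_simp
    have hP := measure_notMem_geometricModulusSet_le (μ := μ) (hU0 ε) hcont (A := A) (r := r)
      (v := M * γ ε ^ 2) (by positivity) hr0 hr1 (by positivity) (fun k j hj => ?_)
      (by rw [hL]; exact hsmall)
    · rw [hL] at hP
      have hlog : Real.log (4 * Real.exp (-(R / γ ε ^ 2))) = Real.log 4 - R / γ ε ^ 2 := by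
        rw [Real.log_mul (by norm_num) (Real.exp_pos _).ne', Real.log_exp]
        ring
      calc _ ≤ ((γ ε ^ 2 : ℝ) : EReal) *
            ENNReal.log (ENNReal.ofReal (4 * Real.exp (-(R / γ ε ^ 2)))) := by
            gcongr
        _ = ((γ ε ^ 2 * Real.log 4 - R : ℝ) : EReal) := by
            rw [ENNReal.log_ofReal_of_pos (by positivity), hlog, ← EReal.coe_mul, mul_sub,
              mul_div_cancel₀ _ (pow_pos hpos 2).ne']
    · have hdist : |(dyadicPoint k (j + 1) : ℝ) - dyadicPoint k j| = (1 / 2 : ℝ) ^ k := by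
        rw [coe_dyadicPoint (by omega), coe_dyadicPoint hj.le, ← sub_div]
        push_cast
        rw [add_sub_cancel_left, abs_of_pos (by positivity), one_div_pow]
      have hne : dyadicPoint k j ≠ dyadicPoint k (j + 1) := by
        intro h
        rw [h, sub_self, abs_zero] at hdist
        exact (pow_pos (by norm_num : (0 : ℝ) < 1 / 2) k).ne hdist
      obtain ⟨w, hw, hwle⟩ := hgauss _ _ hne
      rw [hdist] at hwle
      have hpow : ((1 / 2 : ℝ) ^ k) ^ (2 * τ) = (r ^ k) ^ 4 := by
        rw [hr, ← Real.rpow_natCast, ← Real.rpow_natCast, ← Real.rpow_natCast, ← Real.rpow_mul,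
          ← Real.rpow_mul, ← Real.rpow_mul]
        · congr 1
          push_cast
          ring
        all_goals positivity
      rw [hpow] at hwle
      exact measure_lt_abs_le_of_map_eq_gaussianReal hw (by positivity) hwle (by positivity)
  -- The prefactor 4 contributes only `γ ε ^ 2 * log 4`, which vanishes in the limit.
  refine (limsup_le_limsup hbound).trans (le_of_eq ?_)
  apply Tendsto.limsup_eq
  refine (continuous_coe_real_ereal.tendsto _).comp ?_
  simpa using (hγ2.mul_const (Real.log 4)).sub_const R

/-! ### Gaussian Hilbert spaces -/

section GaussianHilbertSpace

variable {Ω : Type*} [MeasurableSpace Ω] {P : Measure Ω}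

/-- The map `x ↦ exp (i t x)` is `|t|`-Lipschitz, and on a probability space the `L¹` norm is at
most the `L²` norm. -/
lemma continuous_charFun_map_Lp [IsProbabilityMeasure P] (t : ℝ) :
    Continuous fun v : Lp ℝ 2 P => charFun (P.map v) t := by
  have hint : ∀ v : Lp ℝ 2 P, charFun (P.map v) t = ∫ ω, Complex.exp (t * v ω * Complex.I) ∂P := by
    intro v
    rw [charFun_apply_real, integral_map (Lp.aestronglyMeasurable v).aemeasurable
      (by fun_prop : Continuous fun x : ℝ => Complex.exp (t * x * Complex.I)).aestronglyMeasurable]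
  have hintegrable : ∀ v : Lp ℝ 2 P,
      Integrable (fun ω => Complex.exp (t * v ω * Complex.I)) P := by
    intro v
    refine Integrable.of_bound (C := 1) ?_ ?_
    · exact (by fun_prop : Continuous fun x : ℝ =>
        Complex.exp (t * x * Complex.I)).comp_aestronglyMeasurable (Lp.aestronglyMeasurable v)
    · refine ae_of_all _ fun ω => ?_
      rw [← Complex.ofReal_mul, Complex.norm_exp_ofReal_mul_I]
  have hle : ∀ x y : ℝ, ‖Complex.exp (t * x * Complex.I) - Complex.exp (t * y * Complex.I)‖ ≤
      |t| * ‖x - y‖ := by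
    intro x y
    have h := Real.norm_exp_I_mul_ofReal_sub_one_le (x := t * (x - y))
    have hfac : Complex.exp (t * x * Complex.I) - Complex.exp (t * y * Complex.I) =
        Complex.exp ((t * y : ℝ) * Complex.I) *
          (Complex.exp (Complex.I * (t * (x - y) : ℝ)) - 1) := by
      rw [mul_sub, mul_one, ← Complex.exp_add]
      congr 2
      · push_cast; ring
      · push_cast; ring
    rw [hfac, norm_mul, Complex.norm_exp_ofReal_mul_I, one_mul]
    refine h.trans (le_of_eq ?_)
    rw [norm_mul, Real.norm_eq_abs]
  have hlip : LipschitzWith ⟨|t|, abs_nonneg t⟩ fun v : Lp ℝ 2 P => charFun (P.map v) t := by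
    refine LipschitzWith.of_dist_le_mul fun v w => ?_
    rw [dist_eq_norm, dist_eq_norm, hint, hint, ← integral_sub (hintegrable v) (hintegrable w)]
    have hv1 : MemLp (v - w : Lp ℝ 2 P) 1 P := (Lp.memLp (v - w)).mono_exponent one_le_two
    calc ‖∫ ω, (Complex.exp (t * v ω * Complex.I) - Complex.exp (t * w ω * Complex.I)) ∂P‖
        ≤ ∫ ω, |t| * ‖(v - w : Lp ℝ 2 P) ω‖ ∂P := by
          refine norm_integral_le_of_norm_le
            ((memLp_one_iff_integrable.1 hv1).norm.const_mul _) ?_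
          filter_upwards [Lp.coeFn_sub v w] with ω hω
          rw [hω]
          exact hle _ _
      _ = |t| * (eLpNorm (v - w : Lp ℝ 2 P) 1 P).toReal := by
          rw [integral_const_mul, integral_norm_eq_lintegral_enorm hv1.1,
            eLpNorm_one_eq_lintegral_enorm]
      _ ≤ |t| * ‖v - w‖ := by
          gcongr
          rw [Lp.norm_def]
          exact ENNReal.toReal_mono (Lp.eLpNorm_ne_top _)
            (eLpNorm_le_eLpNorm_of_exponent_le one_le_two (Lp.aestronglyMeasurable _))
  exact hlip.continuous

/-- Laws are determined by characteristic functions, and for each `t` both sides are continuous in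
`v`. Writing the variance as `‖v‖²` lets it follow the limit. -/
lemma isClosed_setOf_map_eq_gaussianReal [IsProbabilityMeasure P] :
    IsClosed {v : Lp ℝ 2 P | P.map v = gaussianReal 0 (‖v‖₊ ^ 2)} := by
  have h : {v : Lp ℝ 2 P | P.map v = gaussianReal 0 (‖v‖₊ ^ 2)} =
      ⋂ t : ℝ, {v : Lp ℝ 2 P | charFun (P.map v) t = Complex.exp (-(‖v‖ ^ 2 * t ^ 2 / 2))} := by
    ext v
    have := P.isProbabilityMeasure_map (Lp.aestronglyMeasurable v).aemeasurable
    have hg : ∀ t, charFun (gaussianReal 0 (‖v‖₊ ^ 2)) t =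
        Complex.exp (-(‖v‖ ^ 2 * t ^ 2 / 2)) := by
      intro t
      rw [charFun_gaussianReal]
      congr 1
      simp
    simp only [mem_iInter, mem_ofPred_eq]
    constructor
    · intro hv t
      rw [hv, hg]
    · intro hv
      apply Measure.ext_of_charFun
      ext t
      rw [hv, hg]
  rw [h]
  exact isClosed_iInter fun t => isClosed_eq (continuous_charFun_map_Lp t) (by fun_prop)

lemma map_eq_gaussianReal_of_centered {v : Lp ℝ 2 P} (hv : HasGaussianLaw v P)
    (h0 : ∫ ω, v ω ∂P = 0) : P.map v = gaussianReal 0 (‖v‖₊ ^ 2) := by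
  have := hv.isProbabilityMeasure
  rw [hv.map_eq_gaussianReal, h0]
  congr 1
  rw [variance_of_integral_eq_zero hv.aemeasurable h0]
  have h := real_inner_self_eq_norm_sq v
  rw [L2.inner_def] at h
  have h2 : ∫ ω, v ω ^ 2 ∂P = ‖v‖ ^ 2 := by
    rw [← h]
    refine integral_congr_ae (ae_of_all _ fun ω => ?_)
    simp [sq]
  simp only [h2]
  ext
  simp

/-- The Gaussian Hilbert space of a Gaussian process: the closed linear span of its values
in `L²`. -/
noncomputable def gaussianHilbertSpace {ι : Type*} {Z : ι → Ω → ℝ} (hZ : IsGaussianProcess Z P) :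
    Submodule ℝ (Lp ℝ 2 P) :=
  (Submodule.span ℝ (range fun i => (hZ.hasGaussianLaw_eval i).memLp_two.toLp)).topologicalClosure

variable {ι : Type*} {Z : ι → Ω → ℝ}

lemma toLp_mem_gaussianHilbertSpace (hZ : IsGaussianProcess Z P) (i : ι) :
    (hZ.hasGaussianLaw_eval i).memLp_two.toLp ∈ gaussianHilbertSpace hZ :=
  Submodule.le_topologicalClosure _ (Submodule.subset_span ⟨i, rfl⟩)

/-- Finite combinations of the process are centered Gaussian; closedness carries this to
`L²`-limits. -/
lemma map_eq_gaussianReal_of_mem (hZ : IsGaussianProcess Z P) (h0 : ∀ i, ∫ ω, Z i ω ∂P = 0)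
    {v : Lp ℝ 2 P} (hv : v ∈ gaussianHilbertSpace hZ) :
    P.map v = gaussianReal 0 (‖v‖₊ ^ 2) := by
  have := hZ.isProbabilityMeasure
  refine closure_minimal (s := (Submodule.span ℝ
    (range fun i => (hZ.hasGaussianLaw_eval i).memLp_two.toLp) : Set (Lp ℝ 2 P)))
    (fun w hw => ?_) isClosed_setOf_map_eq_gaussianReal hv
  obtain ⟨c, rfl⟩ := Finsupp.mem_span_range_iff_exists_finsupp.1 hw
  have hae : (fun ω => ∑ i ∈ c.support, c i • Z i ω) =ᵐ[P]
      (c.sum fun i a => a • (hZ.hasGaussianLaw_eval i).memLp_two.toLp : Lp ℝ 2 P) := by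
    have h1 := Lp.coeFn_fun_finsetSum c.support
      fun i => c i • (hZ.hasGaussianLaw_eval i).memLp_two.toLp
    have h2 : ∀ᵐ ω ∂P, ∀ i ∈ c.support,
        (c i • (hZ.hasGaussianLaw_eval i).memLp_two.toLp : Lp ℝ 2 P) ω = c i • Z i ω := by
      refine (Finset.eventually_all c.support).2 fun i _ => ?_
      filter_upwards [Lp.coeFn_smul (c i) (hZ.hasGaussianLaw_eval i).memLp_two.toLp,
        (hZ.hasGaussianLaw_eval i).memLp_two.coeFn_toLp] with ω e1 e2
      rw [e1, Pi.smul_apply, e2]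
    filter_upwards [h1, h2] with ω e1 e2
    rw [Finsupp.sum, e1]
    exact (Finset.sum_congr rfl fun i hi => e2 i hi).symm
  refine map_eq_gaussianReal_of_centered
    (((hZ.smul c).hasGaussianLaw_fun_sum (I := c.support)).congr hae) ?_
  rw [← integral_congr_ae hae, integral_finsetSum _ fun i _ => (?_ :
    Integrable (fun ω => c i • Z i ω) P)]
  swap
  · exact (hZ.hasGaussianLaw_eval i).integrable.smul (c i)
  refine Finset.sum_eq_zero fun i _ => ?_
  rw [integral_smul, h0, smul_zero]

lemma integral_eq_zero_of_mem (hZ : IsGaussianProcess Z P) (h0 : ∀ i, ∫ ω, Z i ω ∂P = 0)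
    {v : Lp ℝ 2 P} (hv : v ∈ gaussianHilbertSpace hZ) : ∫ ω, v ω ∂P = 0 := by
  have h : ∫ x, x ∂(P.map v) = 0 := by
    rw [map_eq_gaussianReal_of_mem hZ h0 hv, integral_id_gaussianReal]
  rwa [integral_map (Lp.aestronglyMeasurable v).aemeasurable (by fun_prop)] at h

lemma covariance_eq_inner_of_mem (hZ : IsGaussianProcess Z P) (h0 : ∀ i, ∫ ω, Z i ω ∂P = 0)
    {v w : Lp ℝ 2 P} (hv : v ∈ gaussianHilbertSpace hZ) (hw : w ∈ gaussianHilbertSpace hZ) :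
    cov[v, w; P] = inner ℝ v w := by
  rw [covariance, integral_eq_zero_of_mem hZ h0 hv, integral_eq_zero_of_mem hZ h0 hw, L2.inner_def]
  refine integral_congr_ae (ae_of_all _ fun ω => ?_)
  simp [mul_comm]

/-- A linear functional of finitely many members is again a member, so the one-dimensional statement
already yields joint Gaussianity. -/
lemma isGaussianProcess_gaussianHilbertSpace (hZ : IsGaussianProcess Z P)
    (h0 : ∀ i, ∫ ω, Z i ω ∂P = 0) :
    IsGaussianProcess (fun (v : gaussianHilbertSpace hZ) ω => (v : Lp ℝ 2 P) ω) P := by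
  classical
  have hP := hZ.isProbabilityMeasure
  refine ⟨fun I => ⟨⟨fun L => ?_⟩⟩⟩
  have hm : AEMeasurable (fun ω => I.restrict
      fun v : gaussianHilbertSpace hZ => (v : Lp ℝ 2 P) ω) P :=
    aemeasurable_pi_lambda _ fun v => (Lp.aestronglyMeasurable (v.1 : Lp ℝ 2 P)).aemeasurable
  set u : Lp ℝ 2 P := ∑ v : I, L (Pi.single v 1) • (v.1 : Lp ℝ 2 P) with hu
  have hmem : u ∈ gaussianHilbertSpace hZ :=
    Submodule.sum_mem _ fun v _ => Submodule.smul_mem _ _ v.1.2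
  have hae : (fun ω => L (I.restrict fun v : gaussianHilbertSpace hZ => (v : Lp ℝ 2 P) ω)) =ᵐ[P]
      u := by
    have h1 := Lp.coeFn_fun_finsetSum (Finset.univ : Finset I)
      fun v => L (Pi.single v 1) • (v.1 : Lp ℝ 2 P)
    have h2 : ∀ᵐ ω ∂P, ∀ v : I, (L (Pi.single v 1) • (v.1 : Lp ℝ 2 P)) ω =
        L (Pi.single v 1) • (v.1 : Lp ℝ 2 P) ω :=
      ae_all_iff.2 fun v => Lp.coeFn_smul (L (Pi.single v 1)) (v.1 : Lp ℝ 2 P)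
    filter_upwards [h1, h2] with ω e1 e2
    rw [hu, e1]
    simp only [e2]
    conv_lhs => rw [← Finset.univ_sum_single
      (I.restrict fun v : gaussianHilbertSpace hZ => (v : Lp ℝ 2 P) ω)]
    rw [map_sum]
    refine Finset.sum_congr rfl fun v _ => ?_
    have hsingle : ∀ a : ℝ, L (Pi.single v a) = L (Pi.single v 1) • a := by
      intro a
      have h : (Pi.single v a : I → ℝ) = a • Pi.single v 1 := by
        rw [← Pi.single_smul, smul_eq_mul, mul_one]
      rw [h, map_smul, smul_eq_mul, smul_eq_mul, mul_comm]
    exact hsingle _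
  have hgauss : HasGaussianLaw (fun ω =>
      L (I.restrict fun v : gaussianHilbertSpace hZ => (v : Lp ℝ 2 P) ω)) P := by
    refine HasGaussianLaw.congr ⟨?_⟩ hae.symm
    rw [map_eq_gaussianReal_of_mem hZ h0 hmem]
    infer_instance
  have h := hgauss.map_eq_gaussianReal
  rw [AEMeasurable.map_map_of_aemeasurable (by fun_prop) hm, integral_map hm (by fun_prop),
    variance_map (by fun_prop) hm]
  exact h

end GaussianHilbertSpace

/-! ### Independent Gaussian processes -/

/-- Two independent Gaussian processes are jointly Gaussian. -/
lemma isGaussianProcess_sumElim_of_indepFun {Ω S T : Type*} [MeasurableSpace Ω] {P : Measure Ω}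
    {X : S → Ω → ℝ} {Y : T → Ω → ℝ} (hX : IsGaussianProcess X P) (hY : IsGaussianProcess Y P)
    (h : IndepFun (fun ω s => X s ω) (fun ω t => Y t ω) P) :
    IsGaussianProcess (Sum.elim X Y) P := by
  refine ⟨fun I => ?_⟩
  have hind : IndepFun (fun ω => I.toLeft.restrict (X · ω)) (fun ω => I.toRight.restrict (Y · ω))
      P := h.comp (Finset.measurable_restrict I.toLeft) (Finset.measurable_restrict I.toRight)
  have hpair := IndepFun.hasGaussianLaw (hX.hasGaussianLaw I.toLeft) (hY.hasGaussianLaw I.toRight)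
    hind
  -- Reassembles the coordinates in `I` linearly from the independent left and right blocks.
  let L : ((I.toLeft → ℝ) × (I.toRight → ℝ)) →L[ℝ] (I → ℝ) := ContinuousLinearMap.pi fun i =>
    match i with
    | ⟨Sum.inl s, hs⟩ => (ContinuousLinearMap.proj (R := ℝ) (φ := fun _ : I.toLeft => ℝ)
        ⟨s, Finset.mem_toLeft.2 hs⟩).comp (ContinuousLinearMap.fst ℝ _ _)
    | ⟨Sum.inr t, ht⟩ => (ContinuousLinearMap.proj (R := ℝ) (φ := fun _ : I.toRight => ℝ)
        ⟨t, Finset.mem_toRight.2 ht⟩).comp (ContinuousLinearMap.snd ℝ _ _)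
  have hL : (fun ω => I.restrict (Sum.elim X Y · ω)) =
      L ∘ fun ω => (I.toLeft.restrict (X · ω), I.toRight.restrict (Y · ω)) := by
    funext ω i
    obtain ⟨s | t, hi⟩ := i <;> rfl
  rw [hL]
  exact hpair.map L

/-! ### Wiener integrals as limits in `L²` -/

section WienerIntegral

lemma memLp_indicator_Ioc (T t : ℝ≥0) :
    MemLp ((Ioc (0 : ℝ) t).indicator fun _ => (1 : ℝ)) 2
      ((volume : Measure ℝ).restrict (Icc (0 : ℝ) T)) :=
  memLp_indicator_const 2 measurableSet_Ioc 1 (Or.inr (measure_ne_top _ _))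

/-- The class of `1_{(0, t]}` in `L²[0, T]`. -/
noncomputable def indicatorLp (T t : ℝ≥0) :
    Lp ℝ 2 ((volume : Measure ℝ).restrict (Icc (0 : ℝ) T)) :=
  (memLp_indicator_Ioc T t).toLp

lemma inner_indicatorLp {T s t : ℝ≥0} (hs : s ≤ T) :
    inner ℝ (indicatorLp T s) (indicatorLp T t) = min s t := by
  rw [L2.inner_def]
  have hae : (fun u => inner ℝ (indicatorLp T s u) (indicatorLp T t u))
      =ᵐ[(volume : Measure ℝ).restrict (Icc (0 : ℝ) T)]
      (Ioc (0 : ℝ) (min s t : ℝ≥0)).indicator fun _ => (1 : ℝ) := by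
    filter_upwards [(memLp_indicator_Ioc T s).coeFn_toLp, (memLp_indicator_Ioc T t).coeFn_toLp]
      with u e1 e2
    rw [indicatorLp, indicatorLp, e1, e2]
    have hset : Ioc (0 : ℝ) (min s t : ℝ≥0) = Ioc (0 : ℝ) s ∩ Ioc (0 : ℝ) t := by
      rw [Ioc_inter_Ioc, NNReal.coe_min, max_self]
    rw [hset]
    by_cases h1 : u ∈ Ioc (0 : ℝ) s <;> by_cases h2 : u ∈ Ioc (0 : ℝ) t <;>
      simp only [indicator, h1, h2, mem_inter_iff, and_true, and_false, if_true,
        if_false] <;> simp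
  rw [integral_congr_ae hae, integral_indicator_const _ measurableSet_Ioc, measureReal_def,
    Measure.restrict_apply measurableSet_Ioc, inter_eq_left.2]
  · rw [Real.volume_Ioc, sub_zero, ENNReal.toReal_ofReal NNReal.zero_le_coe, smul_eq_mul, mul_one]
  · intro u hu
    refine ⟨hu.1.le, hu.2.trans ?_⟩
    exact_mod_cast (min_le_left s t).trans hs

variable {Ω : Type*} [MeasurableSpace Ω] {P : Measure Ω}

/-- A finite combination of increments, as a linear function of the process. -/
def StepFn.comb {T : ℝ≥0} (φ : StepFn T) {H : Type*} [AddCommGroup H] [Module ℝ H] (d : ℝ≥0 → H) :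
    H :=
  ∑ i, φ.c i • (d (φ.b i) - d (φ.a i))

lemma StepFn.toFun_ae_eq {T : ℝ≥0} (φ : StepFn T) :
    StepFn.comb (H := Lp ℝ 2 ((volume : Measure ℝ).restrict (Icc (0 : ℝ) T))) φ
      (indicatorLp T) =ᵐ[(volume : Measure ℝ).restrict (Icc (0 : ℝ) T)] φ.toFun := by
  have h1 := Lp.coeFn_fun_finsetSum (Finset.univ : Finset (Fin φ.m))
    fun i => φ.c i • (indicatorLp T (φ.b i) - indicatorLp T (φ.a i))
  have h2 : ∀ᵐ u ∂((volume : Measure ℝ).restrict (Icc (0 : ℝ) T)), ∀ i,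
      (φ.c i • (indicatorLp T (φ.b i) - indicatorLp T (φ.a i)) :
        Lp ℝ 2 ((volume : Measure ℝ).restrict (Icc (0 : ℝ) T))) u =
        φ.c i * (Ioc (φ.a i : ℝ) (φ.b i : ℝ)).indicator (fun _ => (1 : ℝ)) u := by
    refine ae_all_iff.2 fun i => ?_
    filter_upwards [Lp.coeFn_smul (φ.c i) (indicatorLp T (φ.b i) - indicatorLp T (φ.a i)),
      Lp.coeFn_sub (indicatorLp T (φ.b i)) (indicatorLp T (φ.a i)),
      (memLp_indicator_Ioc T (φ.b i)).coeFn_toLp, (memLp_indicator_Ioc T (φ.a i)).coeFn_toLp]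
      with u e1 e2 e3 e4
    rw [e1, Pi.smul_apply, e2, Pi.sub_apply, indicatorLp, indicatorLp, e3, e4, smul_eq_mul]
    congr 1
    have hab : (φ.a i : ℝ) ≤ φ.b i := by exact_mod_cast φ.a_le_b i
    have ha : (0 : ℝ) ≤ φ.a i := (φ.a i).2
    simp only [indicator, mem_Ioc]
    split_ifs <;> first | (norm_num; done) | (exfalso; grind)
  filter_upwards [h1, h2] with u e1 e2
  rw [StepFn.comb, e1, StepFn.toFun]
  exact Finset.sum_congr rfl fun i _ => e2 i

lemma StepFn.stochInt_ae_eq {T : ℝ≥0} (φ : StepFn T) {W : ℝ≥0 → Ω → ℝ}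
    (hW : ∀ t, MemLp (W t) 2 P) :
    StepFn.comb (H := Lp ℝ 2 P) φ (fun t => (hW t).toLp) =ᵐ[P] φ.stochInt W := by
  have h1 := Lp.coeFn_fun_finsetSum (Finset.univ : Finset (Fin φ.m))
    fun i => φ.c i • ((hW (φ.b i)).toLp - (hW (φ.a i)).toLp)
  have h2 : ∀ᵐ ω ∂P, ∀ i, (φ.c i • ((hW (φ.b i)).toLp - (hW (φ.a i)).toLp) : Lp ℝ 2 P) ω =
      φ.c i * (W (φ.b i) ω - W (φ.a i) ω) := by
    refine ae_all_iff.2 fun i => ?_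
    filter_upwards [Lp.coeFn_smul (φ.c i) ((hW (φ.b i)).toLp - (hW (φ.a i)).toLp),
      Lp.coeFn_sub (hW (φ.b i)).toLp (hW (φ.a i)).toLp, (hW (φ.b i)).coeFn_toLp,
      (hW (φ.a i)).coeFn_toLp] with ω e1 e2 e3 e4
    rw [e1, Pi.smul_apply, e2, Pi.sub_apply, e3, e4, smul_eq_mul]
  filter_upwards [h1, h2] with ω e1 e2
  rw [StepFn.comb, e1, StepFn.stochInt]
  exact Finset.sum_congr rfl fun i _ => e2 i

/-- The Itô isometry on step functions is bilinearity: it suffices to compare the inner products of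
the generators, here `W t` and the indicator of `(0, t]`. -/
lemma StepFn.inner_comb {T : ℝ≥0} {H₁ H₂ : Type*} [NormedAddCommGroup H₁] [InnerProductSpace ℝ H₁]
    [NormedAddCommGroup H₂] [InnerProductSpace ℝ H₂] {d : ℝ≥0 → H₁} {e : ℝ≥0 → H₂} {c : ℝ}
    (h : ∀ s t, s ≤ T → t ≤ T → inner ℝ (d s) (d t) = c * inner ℝ (e s) (e t)) (φ ψ : StepFn T) :
    inner ℝ (φ.comb d) (ψ.comb d) = c * inner ℝ (φ.comb e) (ψ.comb e) := by
  rw [StepFn.comb, StepFn.comb, StepFn.comb, StepFn.comb, sum_inner, sum_inner, Finset.mul_sum]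
  refine Finset.sum_congr rfl fun i _ => ?_
  rw [inner_sum, inner_sum, Finset.mul_sum]
  refine Finset.sum_congr rfl fun j _ => ?_
  simp only [real_inner_smul_left, real_inner_smul_right, inner_sub_left, inner_sub_right]
  have hφ := (φ.a_le_b i).trans (φ.b_le_T i)
  have hψ := (ψ.a_le_b j).trans (ψ.b_le_T j)
  rw [h _ _ (φ.b_le_T i) (ψ.b_le_T j), h _ _ (φ.b_le_T i) hψ, h _ _ hφ (ψ.b_le_T j), h _ _ hφ hψ]
  ring

lemma tendsto_Lp_of_ae_eq {α : Type*} [MeasurableSpace α] {μ : Measure α} {u : ℕ → Lp ℝ 2 μ}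
    {v : ℕ → α → ℝ} (huv : ∀ n, u n =ᵐ[μ] v n) {w : α → ℝ} (hw : MemLp w 2 μ)
    (h : Tendsto (fun n => eLpNorm (fun x => v n x - w x) 2 μ) atTop (𝓝 0)) :
    Tendsto u atTop (𝓝 hw.toLp) := by
  rw [Lp.tendsto_Lp_iff_tendsto_eLpNorm']
  refine h.congr fun n => eLpNorm_congr_ae ?_
  filter_upwards [huv n, hw.coeFn_toLp] with x e1 e2
  rw [Pi.sub_apply, e1, e2]

lemma IsWienerIntegral.exists_tendsto {W : ℝ≥0 → Ω → ℝ} {T : ℝ≥0} {f : ℝ → ℝ} {Y : Ω → ℝ}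
    (h : IsWienerIntegral W P T f Y) (hW : ∀ t, MemLp (W t) 2 P) :
    ∃ φ : ℕ → StepFn T,
      Tendsto (fun N => (φ N).comb (indicatorLp T)) atTop (𝓝 h.memLp_integrand.toLp) ∧
      Tendsto (fun N => (φ N).comb fun t => (hW t).toLp) atTop (𝓝 h.memLp_integral.toLp) := by
  obtain ⟨φ, h1, h2⟩ := h.exists_approx
  exact ⟨φ, tendsto_Lp_of_ae_eq (fun N => (φ N).toFun_ae_eq) _ h1,
    tendsto_Lp_of_ae_eq (fun N => (φ N).stochInt_ae_eq hW) _ h2⟩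

lemma IsWienerIntegral.toLp_mem {W : ℝ≥0 → Ω → ℝ} {T : ℝ≥0} {f : ℝ → ℝ} {Y : Ω → ℝ}
    (h : IsWienerIntegral W P T f Y) (hW : ∀ t, MemLp (W t) 2 P) {V : Submodule ℝ (Lp ℝ 2 P)}
    (hV : IsClosed (V : Set (Lp ℝ 2 P))) (hWV : ∀ t, (hW t).toLp ∈ V) :
    h.memLp_integral.toLp ∈ V := by
  obtain ⟨φ, -, hφ⟩ := h.exists_tendsto hW
  exact hV.mem_of_tendsto hφ (Eventually.of_forall fun N =>
    V.sum_mem fun i _ => V.smul_mem _ (V.sub_mem (hWV _) (hWV _)))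

/-- The Itô isometry for deterministic integrands. -/
lemma IsWienerIntegral.inner_eq {W : ℝ≥0 → Ω → ℝ} {T : ℝ≥0} {f f' : ℝ → ℝ} {Y Y' : Ω → ℝ}
    (h : IsWienerIntegral W P T f Y) (h' : IsWienerIntegral W P T f' Y')
    (hW : ∀ t, MemLp (W t) 2 P) {c : ℝ}
    (hcov : ∀ s t, inner ℝ (hW s).toLp (hW t).toLp = c * (min s t : ℝ≥0)) :
    inner ℝ h.memLp_integral.toLp h'.memLp_integral.toLp =
      c * inner ℝ h.memLp_integrand.toLp h'.memLp_integrand.toLp := by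
  obtain ⟨φ, h1, h2⟩ := h.exists_tendsto hW
  obtain ⟨ψ, h1', h2'⟩ := h'.exists_tendsto hW
  refine tendsto_nhds_unique (h2.inner h2') ?_
  refine ((h1.inner h1').const_mul c).congr fun N => ?_
  refine (StepFn.inner_comb (fun s t hs _ => ?_) (φ N) (ψ N)).symm
  rw [hcov, inner_indicatorLp hs]

end WienerIntegral

/-! ### Gaussian vectors with full support and conditional laws -/

section Conditioning

variable {Ω : Type*} [MeasurableSpace Ω] {P : Measure Ω} {n : ℕ}

open scoped MatrixOrder Matrix.Norms.L2Operator in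
-- The law is the image of the standard Gaussian, which has full support, under the map `CFC.sqrt
-- C`, surjective because `C` is invertible.
lemma isOpenPosMeasure_multivariateGaussian {C : Matrix (Fin n) (Fin n) ℝ} (hC : C.PosDef) :
    (multivariateGaussian 0 C).IsOpenPosMeasure := by
  have h1 : (gaussianReal 0 1).IsOpenPosMeasure :=
    (gaussianReal_absolutelyContinuous' 0 one_ne_zero).isOpenPosMeasure
  have h2 : (stdGaussian (EuclideanSpace ℝ (Fin n))).IsOpenPosMeasure := by
    rw [← map_pi_eq_stdGaussian]
    exact (PiLp.continuous_toLp 2 _).isOpenPosMeasure_map (WithLp.toLp_surjective 2)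
  have hu : IsUnit (CFC.sqrt C) := by
    have h : CFC.sqrt C * CFC.sqrt C = C := CFC.sqrt_mul_sqrt_self C hC.posSemidef.nonneg
    exact isUnit_of_mul_isUnit_left (y := CFC.sqrt C) (by rw [h]; exact hC.isUnit)
  obtain ⟨u, hu⟩ := hu.map (Matrix.toEuclideanCLM (n := Fin n) (𝕜 := ℝ))
  rw [multivariateGaussian]
  refine Continuous.isOpenPosMeasure_map (by fun_prop) fun y => ⟨(u⁻¹ : (_)ˣ).1 y, ?_⟩
  simp only [zero_add]
  rw [← hu, ← mul_apply_eq_comp, Units.mul_inv, one_apply_eq_self]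

/-- A centered Gaussian vector with a positive definite covariance matrix has full support. -/
lemma isOpenPosMeasure_map_of_posDef {G : Fin n → Ω → ℝ}
    (hG : HasGaussianLaw (fun ω i => G i ω) P) (h0 : ∀ i, ∫ ω, G i ω ∂P = 0)
    (hC : (Matrix.of fun i j => cov[G i, G j; P]).PosDef) :
    (P.map fun ω i => G i ω).IsOpenPosMeasure := by
  have := hG.isProbabilityMeasure
  set C : Matrix (Fin n) (Fin n) ℝ := Matrix.of fun i j => cov[G i, G j; P] with hCdef
  have hGm := hG.aemeasurable
  have hlp := hG.toLp_pi 2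
  have hmap : P.map (fun ω => WithLp.toLp 2 fun i => G i ω) = multivariateGaussian 0 C := by
    have := hlp.isGaussian_map
    apply IsGaussian.ext
    · rw [integral_id_multivariateGaussian', integral_map hlp.aemeasurable (by fun_prop)]
      ext i
      have h := (EuclideanSpace.proj (𝕜 := ℝ) i).integral_comp_comm hlp.integrable
      simpa [h0 i] using h.symm
    · ext x y
      rw [covarianceBilin_multivariateGaussian hC.posSemidef,
        covarianceBilin_apply_pi fun i => (hG.eval i).memLp_two]
      simp only [dotProduct, Matrix.mulVec, Finset.mul_sum]
      refine Finset.sum_congr rfl fun i _ => Finset.sum_congr rfl fun j _ => ?_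
      rw [hCdef, Matrix.of_apply]
      ring
  have hpos := isOpenPosMeasure_multivariateGaussian hC
  rw [← hmap] at hpos
  have h := (PiLp.continuous_ofLp 2 fun _ : Fin n => ℝ).isOpenPosMeasure_map
    (μ := P.map (fun ω => WithLp.toLp 2 fun i => G i ω)) (WithLp.ofLp_surjective 2)
  rwa [AEMeasurable.map_map_of_aemeasurable
    (PiLp.continuous_ofLp 2 fun _ : Fin n => ℝ).aemeasurable hlp.aemeasurable] at h

/-- The kernel `x ↦ N(a · x, v)`. -/
noncomputable def gaussianAffineKernel (a : Fin n → ℝ) (v : ℝ≥0) : Kernel (Fin n → ℝ) ℝ :=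
  (Kernel.id ×ₖ Kernel.const _ (gaussianReal 0 v)).map fun p => a ⬝ᵥ p.1 + p.2

lemma measurable_dotProduct_add (a : Fin n → ℝ) :
    Measurable fun p : (Fin n → ℝ) × ℝ => a ⬝ᵥ p.1 + p.2 := by
  unfold dotProduct
  fun_prop

instance (a : Fin n → ℝ) (v : ℝ≥0) : IsMarkovKernel (gaussianAffineKernel a v) :=
  Kernel.IsMarkovKernel.map _ (measurable_dotProduct_add a)

lemma gaussianAffineKernel_apply (a : Fin n → ℝ) (v : ℝ≥0) (x : Fin n → ℝ) :
    gaussianAffineKernel a v x = gaussianReal (a ⬝ᵥ x) v := by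
  rw [gaussianAffineKernel, Kernel.map_apply _ (measurable_dotProduct_add a), Kernel.prod_apply,
    Kernel.id_apply, Kernel.const_apply, Measure.dirac_prod,
    Measure.map_map (measurable_dotProduct_add a) (by fun_prop)]
  have h : (fun p : (Fin n → ℝ) × ℝ => a ⬝ᵥ p.1 + p.2) ∘ Prod.mk x = fun z => a ⬝ᵥ x + z := rfl
  rw [h, gaussianReal_map_const_add, zero_add]

lemma continuous_integral_gaussianReal_dotProduct (a : Fin n → ℝ) (v : ℝ≥0) (φ : ℝ →ᵇ ℝ) :
    Continuous fun x : Fin n → ℝ => ∫ z, φ z ∂(gaussianReal (a ⬝ᵥ x) v) := by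
  have h : ∀ x : Fin n → ℝ, ∫ z, φ z ∂(gaussianReal (a ⬝ᵥ x) v) =
      ∫ z, φ (a ⬝ᵥ x + z) ∂(gaussianReal 0 v) := by
    intro x
    rw [← integral_map (φ := fun z => a ⬝ᵥ x + z) (by fun_prop)
      φ.continuous.aestronglyMeasurable, gaussianReal_map_const_add, zero_add]
  simp only [h]
  refine continuous_of_dominated (bound := fun _ => ‖φ‖) (fun x => ?_) (fun x => ?_)
    (integrable_const _) (ae_of_all _ fun z => ?_)
  · exact (φ.continuous.comp (by fun_prop)).aestronglyMeasurable
  · exact ae_of_all _ fun z => φ.norm_coe_le_norm _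
  · refine φ.continuous.comp ?_
    unfold dotProduct
    fun_prop

/-- The conditional law of a component of a centered Gaussian vector given the other components,
when these have a positive definite covariance matrix. -/
lemma exists_hasCondDistrib_gaussianAffineKernel {G : Fin n → Ω → ℝ} {D : Ω → ℝ}
    (hGD : IsGaussianProcess (Sum.elim G fun _ : Unit => D) P) (hD0 : ∫ ω, D ω ∂P = 0)
    (hG0 : ∀ i, ∫ ω, G i ω ∂P = 0) (hC : (Matrix.of fun i j => cov[G i, G j; P]).PosDef) :
    ∃ v : ℝ≥0, (v : ℝ) ≤ Var[D; P] ∧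
      HasCondDistrib D (fun ω i => G i ω) (gaussianAffineKernel
        ((Matrix.of fun i j => cov[G i, G j; P])⁻¹.mulVec fun i => cov[D, G i; P]) v) P := by
  classical
  have := hGD.isProbabilityMeasure
  set C : Matrix (Fin n) (Fin n) ℝ := Matrix.of fun i j => cov[G i, G j; P] with hCdef
  set b : Fin n → ℝ := fun i => cov[D, G i; P] with hb
  -- The regression coefficients: `C a = b` says exactly that `D - a ⬝ᵥ G` is uncorrelated with
  -- every `G i`, hence independent of `G` by joint Gaussianity.
  set a : Fin n → ℝ := C⁻¹.mulVec b with ha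
  have hCa : C.mulVec a = b := by
    rw [ha, Matrix.mulVec_mulVec, Matrix.mul_nonsing_inv _ ((Matrix.isUnit_iff_isUnit_det C).1
      hC.isUnit), Matrix.one_mulVec]
  have hG : ∀ i, HasGaussianLaw (G i) P := fun i => hGD.hasGaussianLaw_eval (Sum.inl i)
  have hD : HasGaussianLaw D P := hGD.hasGaussianLaw_eval (Sum.inr ())
  have haG : ∀ i, MemLp (fun ω => a i * G i ω) 2 P := fun i => (hG i).memLp_two.const_mul _
  set S : Ω → ℝ := fun ω => ∑ i, a i * G i ω with hS
  have hS2 : MemLp S 2 P := memLp_finsetSum _ fun i _ => haG i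
  have hGZ : IsGaussianProcess (Sum.elim G fun (_ : Unit) ω => D ω - S ω) P := by
    refine hGD.of_isGaussianProcess ?_
    rintro (i | u)
    · exact ⟨{Sum.inl i}, ContinuousLinearMap.proj ⟨Sum.inl i, by simp⟩, fun ω => rfl⟩
    · refine ⟨Finset.univ, ContinuousLinearMap.proj ⟨Sum.inr (), by simp⟩ -
        ∑ i, a i • ContinuousLinearMap.proj ⟨Sum.inl i, by simp⟩, fun ω => ?_⟩
      simp [hS]
  have hZ : HasGaussianLaw (fun ω => D ω - S ω) P := hGZ.hasGaussianLaw_eval (Sum.inr ())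
  have hcov : ∀ i, cov[G i, fun ω => D ω - S ω; P] = 0 := by
    intro i
    rw [covariance_fun_sub_right (hG i).memLp_two hD.memLp_two hS2, hS,
      covariance_fun_sum_right haG (hG i).memLp_two, covariance_comm (G i) D]
    have h := congr_fun hCa i
    rw [Matrix.mulVec, dotProduct] at h
    rw [sub_eq_zero]
    refine h.symm.trans ?_
    refine Finset.sum_congr rfl fun j _ => ?_
    rw [covariance_const_mul_right, hCdef, Matrix.of_apply, mul_comm]
  have hind : IndepFun (fun ω i => G i ω) (fun ω => D ω - S ω) P := by
    have h := hGZ.indepFun_of_covariance_eq_zero (fun i => (hG i).aemeasurable)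
      (fun _ => hZ.aemeasurable) fun i _ => hcov i
    exact h.comp measurable_id (measurable_pi_apply ())
  have hmS : Measurable fun x : Fin n → ℝ => a ⬝ᵥ x := by
    unfold dotProduct
    fun_prop
  have hvar : Var[D; P] = Var[S; P] + Var[fun ω => D ω - S ω; P] := by
    have h : Var[S + (D - S); P] = Var[S; P] + Var[D - S; P] :=
      (hind.comp hmS measurable_id).variance_add hS2 (hD.memLp_two.sub hS2)
    rwa [add_sub_cancel] at h
  have hZ0 : ∫ ω, (D ω - S ω) ∂P = 0 := by
    rw [integral_sub hD.integrable (hS2.integrable one_le_two), hD0, hS,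
      integral_finsetSum _ fun i _ => (haG i).integrable one_le_two]
    simp [integral_const_mul, hG0]
  have hlaw := hZ.map_eq_gaussianReal
  rw [hZ0] at hlaw
  refine ⟨Var[fun ω => D ω - S ω; P].toNNReal, ?_, ?_, ?_⟩
  · rw [Real.coe_toNNReal _ (variance_nonneg _ _), hvar]
    linarith [variance_nonneg S P]
  · have hGm : AEMeasurable (fun ω i => G i ω) P :=
      aemeasurable_pi_lambda _ fun i => (hG i).aemeasurable
    exact hGm.prodMk hD.aemeasurable
  · have hGm : AEMeasurable (fun ω i => G i ω) P :=
      aemeasurable_pi_lambda _ fun i => (hG i).aemeasurable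
    have := P.isProbabilityMeasure_map hGm
    have hprod := (indepFun_iff_map_prod_eq_prod_map_map hGm hZ.aemeasurable).1 hind
    -- The joint law of `(G, D)` is the image of a product measure under this shear, which is the
    -- disintegration sought.
    have hshear : Measurable fun p : (Fin n → ℝ) × ℝ => (p.1, a ⬝ᵥ p.1 + p.2) :=
      measurable_fst.prodMk (measurable_dotProduct_add a)
    have hGD_eq : (fun ω => ((fun i => G i ω), D ω)) =
        (fun p : (Fin n → ℝ) × ℝ => (p.1, a ⬝ᵥ p.1 + p.2)) ∘
          fun ω => ((fun i => G i ω), D ω - S ω) := by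
      ext ω <;> simp [hS, dotProduct]
    rw [hGD_eq, ← AEMeasurable.map_map_of_aemeasurable hshear.aemeasurable
      (hGm.prodMk hZ.aemeasurable), hprod, hlaw]
    ext s hs
    rw [Measure.map_apply hshear hs, Measure.prod_apply (hshear hs), Measure.compProd_apply hs]
    refine lintegral_congr fun x => ?_
    rw [gaussianAffineKernel_apply, ← zero_add (a ⬝ᵥ x), ← gaussianReal_map_add_const,
      Measure.map_apply (by fun_prop) (measurable_prodMk_left hs)]
    congr 1
    ext z
    simp [add_comm]

/-- If the law of `G` has full support, then a conditional law of `L (X)` given `G` that is affine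
Gaussian gives the law of `L` under the weakly continuous version `κ x` for every single `x`. -/
lemma map_eq_gaussianReal_of_isConditionedLaw [IsProbabilityMeasure P] {X : Ω → C(ℝ≥0, ℝ)}
    {G : Fin n → Ω → ℝ} {κ : Kernel (Fin n → ℝ) C(ℝ≥0, ℝ)} (hκ : IsConditionedLaw X G P κ)
    (hpos : (P.map fun ω i => G i ω).IsOpenPosMeasure) {L : C(ℝ≥0, ℝ) → ℝ} (hL : Continuous L)
    {a : Fin n → ℝ} {v : ℝ≥0}
    (h : HasCondDistrib (fun ω => L (X ω)) (fun ω i => G i ω) (gaussianAffineKernel a v) P)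
    (x : Fin n → ℝ) : (κ x).map L = gaussianReal (a ⬝ᵥ x) v := by
  have := hκ.markov
  have := Kernel.IsMarkovKernel.map κ hL.measurable
  have h1 := hκ.hasCondDistrib.comp_left hL.measurable
  have hae : κ.map L =ᵐ[P.map fun ω i => G i ω] gaussianAffineKernel a v :=
    (condDistrib_ae_eq_of_measure_eq_compProd _ h.aemeasurable_snd h1.map_eq).symm.trans
      (condDistrib_ae_eq_of_measure_eq_compProd _ h.aemeasurable_snd h.map_eq)
  have hprob : IsProbabilityMeasure ((κ x).map L) :=
    Measure.isProbabilityMeasure_map hL.aemeasurable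
  refine ext_of_forall_integral_eq_of_IsFiniteMeasure fun φ => ?_
  have hmap : ∀ y, ∫ z, φ z ∂((κ y).map L) = ∫ f, (φ.compContinuous ⟨L, hL⟩) f ∂(κ y) := fun y =>
    integral_map hL.aemeasurable φ.continuous.aestronglyMeasurable
  -- Two continuous functions of `y` that agree almost everywhere for a measure of full support
  -- agree everywhere.
  have hfun : (fun y => ∫ z, φ z ∂((κ y).map L)) =
      fun y => ∫ z, φ z ∂(gaussianReal (a ⬝ᵥ y) v) := by
    refine (Continuous.ae_eq_iff_eq (P.map fun ω i => G i ω) ?_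
      (continuous_integral_gaussianReal_dotProduct a v φ)).1 ?_
    · simp only [hmap]
      exact hκ.weakly_continuous _
    · filter_upwards [hae] with y hy
      rw [← gaussianAffineKernel_apply, ← hy, Kernel.map_apply _ hL.measurable]
  exact congr_fun hfun x

end Conditioning

/-! ### The Gaussian space of two independent Brownian motions -/

section Volterra

variable {Ω : Type*} [MeasurableSpace Ω] {P : Measure Ω}

lemma covariance_eq_inner_toLp {ι : Type*} {Z : ι → Ω → ℝ} (hZ : IsGaussianProcess Z P)
    (h0 : ∀ i, ∫ ω, Z i ω ∂P = 0) {f g : Ω → ℝ} (hf : MemLp f 2 P) (hg : MemLp g 2 P)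
    (hfV : hf.toLp ∈ gaussianHilbertSpace hZ) (hgV : hg.toLp ∈ gaussianHilbertSpace hZ) :
    cov[f, g; P] = inner ℝ hf.toLp hg.toLp := by
  rw [← covariance_eq_inner_of_mem hZ h0 hfV hgV, covariance, covariance,
    integral_congr_ae hf.coeFn_toLp, integral_congr_ae hg.coeFn_toLp]
  refine integral_congr_ae ?_
  filter_upwards [hf.coeFn_toLp, hg.coeFn_toLp] with ω e1 e2
  rw [e1, e2]

lemma integral_eq_zero_of_toLp_mem {ι : Type*} {Z : ι → Ω → ℝ} (hZ : IsGaussianProcess Z P)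
    (h0 : ∀ i, ∫ ω, Z i ω ∂P = 0) {f : Ω → ℝ} (hf : MemLp f 2 P)
    (hfV : hf.toLp ∈ gaussianHilbertSpace hZ) : ∫ ω, f ω ∂P = 0 := by
  rw [← integral_eq_zero_of_mem hZ h0 hfV]
  exact integral_congr_ae hf.coeFn_toLp.symm

lemma isGaussianProcess_of_toLp_mem {ι κ : Type*} {Z : ι → Ω → ℝ} (hZ : IsGaussianProcess Z P)
    (h0 : ∀ i, ∫ ω, Z i ω ∂P = 0) {Y : κ → Ω → ℝ} (hY : ∀ k, MemLp (Y k) 2 P)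
    (hYV : ∀ k, (hY k).toLp ∈ gaussianHilbertSpace hZ) : IsGaussianProcess Y P :=
  ((isGaussianProcess_gaussianHilbertSpace hZ h0).comp_right
    fun k => (⟨(hY k).toLp, hYV k⟩ : gaussianHilbertSpace hZ)).congr fun k => (hY k).coeFn_toLp

/-- The conditional law of an increment of a Volterra process is Gaussian, and its variance is at
most the unconditional one. -/
lemma exists_map_increment_eq_gaussianReal [IsProbabilityMeasure P]
    {B B' : ℝ≥0 → Ω → ℝ} (hB : IsBrownianReal B P) (hB' : IsBrownianReal B' P)
    (hBB' : IndepFun (fun ω t => B t ω) (fun ω t => B' t ω) P)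
    {α α' : ℝ} (hα : α ≠ 0 ∨ α' ≠ 0)
    {X : Ω → C(ℝ≥0, ℝ)} (hX : IsVolterraProcess (fun t ω => X ω t) B P)
    {T : ℝ≥0} {n : ℕ} {g : Fin n → Lp ℝ 2 ((volume : Measure ℝ).restrict (Icc (0 : ℝ) T))}
    (hg : LinearIndependent ℝ g) {G : Fin n → Ω → ℝ}
    (hG : ∀ i, IsWienerIntegral (mixedBM α α' B B') P T (g i) (G i))
    {κ : Kernel (Fin n → ℝ) C(ℝ≥0, ℝ)} (hκ : IsConditionedLaw X G P κ) (s t : ℝ≥0) :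
    ∃ v : ℝ≥0, (v : ℝ) ≤ Var[fun ω => X ω t - X ω s; P] ∧
      ∀ x, (κ x).map (fun f => f t - f s) = gaussianReal
        (((Matrix.of fun i j => cov[G i, G j; P])⁻¹.mulVec
          fun i => cov[fun ω => X ω t - X ω s, G i; P]) ⬝ᵥ x) v := by
  have hZ := isGaussianProcess_sumElim_of_indepFun hB.isGaussianProcess hB'.isGaussianProcess hBB'
  have h0 : ∀ i, ∫ ω, Sum.elim B B' i ω ∂P = 0 := by
    rintro (r | r)
    · exact hB.integral_eval r
    · exact hB'.integral_eval r
  have hBm : ∀ r, MemLp (B r) 2 P := fun r => (hB.isGaussianProcess.hasGaussianLaw_eval r).memLp_two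
  have hBm' : ∀ r, MemLp (B' r) 2 P :=
    fun r => (hB'.isGaussianProcess.hasGaussianLaw_eval r).memLp_two
  have hBV : ∀ r, (hBm r).toLp ∈ gaussianHilbertSpace hZ :=
    fun r => toLp_mem_gaussianHilbertSpace hZ (Sum.inl r)
  have hBV' : ∀ r, (hBm' r).toLp ∈ gaussianHilbertSpace hZ :=
    fun r => toLp_mem_gaussianHilbertSpace hZ (Sum.inr r)
  have hclosed : IsClosed (gaussianHilbertSpace hZ : Set (Lp ℝ 2 P)) :=
    Submodule.isClosed_topologicalClosure _
  have hW : ∀ r, MemLp (mixedBM α α' B B' r) 2 P := fun r =>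
    ((hBm r).const_mul α).add ((hBm' r).const_mul α')
  have hWeq : ∀ r, (hW r).toLp = α • (hBm r).toLp + α' • (hBm' r).toLp := fun r => rfl
  have hWV : ∀ r, (hW r).toLp ∈ gaussianHilbertSpace hZ := fun r => by
    rw [hWeq]
    exact Submodule.add_mem _ (Submodule.smul_mem _ _ (hBV r)) (Submodule.smul_mem _ _ (hBV' r))
  have hcross : ∀ r q, inner ℝ (hBm r).toLp (hBm' q).toLp = 0 := by
    intro r q
    rw [← covariance_eq_inner_toLp hZ h0 _ _ (hBV r) (hBV' q)]
    exact (hBB'.comp (measurable_pi_apply r) (measurable_pi_apply q)).covariance_eq_zero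
      (hBm r) (hBm' q)
  have hWcov : ∀ r q, inner ℝ (hW r).toLp (hW q).toLp = (α ^ 2 + α' ^ 2) * (min r q : ℝ≥0) := by
    intro r q
    have h1 : inner ℝ (hBm r).toLp (hBm q).toLp = (min r q : ℝ≥0) := by
      rw [← covariance_eq_inner_toLp hZ h0 _ _ (hBV r) (hBV q), hB.covariance_eval]
    have h2 : inner ℝ (hBm' r).toLp (hBm' q).toLp = (min r q : ℝ≥0) := by
      rw [← covariance_eq_inner_toLp hZ h0 _ _ (hBV' r) (hBV' q), hB'.covariance_eval]
    have h3 : inner ℝ (hBm' r).toLp (hBm q).toLp = 0 := by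
      rw [real_inner_comm]
      exact hcross q r
    rw [hWeq, hWeq, inner_add_left, inner_add_right, inner_add_right]
    simp only [real_inner_smul_left, real_inner_smul_right, h1, h2, h3, hcross]
    ring
  have hGm : ∀ i, MemLp (G i) 2 P := fun i => (hG i).memLp_integral
  have hGV : ∀ i, (hGm i).toLp ∈ gaussianHilbertSpace hZ :=
    fun i => (hG i).toLp_mem hW hclosed hWV
  have hXm : ∀ r, MemLp (fun ω => X ω r) 2 P :=
    fun r => (hX.gaussian.hasGaussianLaw_eval r).memLp_two
  have hXV : ∀ r, (hXm r).toLp ∈ gaussianHilbertSpace hZ := by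
    intro r
    -- The horizon must be positive, and `r` may be `0`.
    obtain ⟨K, -, -, hK⟩ := hX.exists_kernel (r + 1) (by positivity)
    exact (hK r le_self_add).toLp_mem hBm hclosed hBV
  have hDm : MemLp (fun ω => X ω t - X ω s) 2 P := (hXm t).sub (hXm s)
  have hDV : hDm.toLp ∈ gaussianHilbertSpace hZ := Submodule.sub_mem _ (hXV t) (hXV s)
  have hC : (Matrix.of fun i j => cov[G i, G j; P]).PosDef := by
    have hc : 0 < α ^ 2 + α' ^ 2 := by
      rcases hα with h | h <;> positivity
    have heq : (Matrix.of fun i j => cov[G i, G j; P]) = (α ^ 2 + α' ^ 2) • Matrix.gram ℝ g := by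
      ext i j
      rw [Matrix.of_apply, covariance_eq_inner_toLp hZ h0 _ _ (hGV i) (hGV j),
        (hG i).inner_eq (hG j) hW hWcov, Lp.toLp_coeFn, Lp.toLp_coeFn]
      rfl
    rw [heq]
    exact (Matrix.posDef_gram_of_linearIndependent hg).smul hc
  have hG0 : ∀ i, ∫ ω, G i ω ∂P = 0 := fun i =>
    integral_eq_zero_of_toLp_mem hZ h0 (hGm i) (hGV i)
  have hGgauss : HasGaussianLaw (fun ω i => G i ω) P := by
    let L : ({i // i ∈ (Finset.univ : Finset (Fin n))} → ℝ) →L[ℝ] (Fin n → ℝ) :=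
      ContinuousLinearMap.pi fun i => ContinuousLinearMap.proj ⟨i, Finset.mem_univ i⟩
    exact ((isGaussianProcess_of_toLp_mem hZ h0 hGm hGV).hasGaussianLaw Finset.univ).map L
  have hGD : IsGaussianProcess (Sum.elim G fun (_ : Unit) ω => X ω t - X ω s) P := by
    refine isGaussianProcess_of_toLp_mem hZ h0 (Sum.rec hGm fun _ => hDm) ?_
    rintro (i | u)
    · exact hGV i
    · exact hDV
  obtain ⟨v, hv, hcond⟩ := exists_hasCondDistrib_gaussianAffineKernel hGD
    (integral_eq_zero_of_toLp_mem hZ h0 hDm hDV) hG0 hC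
  refine ⟨v, hv, map_eq_gaussianReal_of_isConditionedLaw hκ
    (isOpenPosMeasure_map_of_posDef hGgauss hG0 hC) (by fun_prop) hcond⟩

end Volterra

/-! ### Continuity of the conditional mean and the main theorem -/

/-- The conditional mean of an increment is linear in its covariances with `G`, so their Hölder
bound passes to the mean, with a constant depending on `x`. -/
lemma abs_mulVec_dotProduct_le {n : ℕ} (A : Matrix (Fin n) (Fin n) ℝ) (b x : Fin n → ℝ) {β : ℝ}
    (hb : ∀ i, |b i| ≤ β) : |A.mulVec b ⬝ᵥ x| ≤ (∑ i, ∑ j, |A i j| * |x i|) * β := by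
  rw [dotProduct, Finset.sum_mul]
  refine (Finset.abs_sum_le_sum_abs _ _).trans (Finset.sum_le_sum fun i _ => ?_)
  rw [abs_mul, Matrix.mulVec, dotProduct, Finset.sum_mul]
  refine (mul_le_mul_of_nonneg_right (Finset.abs_sum_le_sum_abs _ _) (abs_nonneg _)).trans ?_
  rw [Finset.sum_mul]
  refine Finset.sum_le_sum fun j _ => ?_
  rw [abs_mul, mul_right_comm]
  exact mul_le_mul_of_nonneg_left (hb j) (by positivity)

lemma continuous_of_abs_sub_le_rpow {m : unitInterval → ℝ} {C τ : ℝ} (hτ : 0 < τ)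
    (h : ∀ s t, s ≠ t → |m t - m s| ≤ C * |(t : ℝ) - s| ^ τ) : Continuous m := by
  refine continuous_iff_continuousAt.2 fun s => ?_
  rw [ContinuousAt, tendsto_iff_norm_sub_tendsto_zero]
  have hlim : Tendsto (fun t : unitInterval => C * |(t : ℝ) - s| ^ τ) (𝓝 s) (𝓝 0) := by
    have hc : Continuous fun t : unitInterval => C * |(t : ℝ) - s| ^ τ :=
      continuous_const.mul
        (((continuous_subtype_val.sub continuous_const).abs).rpow_const fun _ => Or.inr hτ.le)
    have h := hc.tendsto s
    simpa [Real.zero_rpow hτ.ne'] using h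
  refine squeeze_zero (fun t => norm_nonneg _) (fun t => ?_) hlim
  rcases eq_or_ne s t with rfl | hst
  · simp [Real.zero_rpow hτ.ne']
  · exact h s t hst

lemma continuous_zoomTime (T ε : ℝ≥0) : Continuous (zoomTime T ε) := by
  have h : Continuous unitInterval.toNNReal := by fun_prop
  exact continuous_const.add (continuous_const.mul h)

lemma centeredIncrement_zero (μ : Measure C(ℝ≥0, ℝ)) (T ε : ℝ≥0) (f : C(ℝ≥0, ℝ)) :
    centeredIncrement μ T ε 0 f = 0 := by
  have h : zoomTime T ε 0 = T := by simp [zoomTime]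
  simp [centeredIncrement, h]

theorem proposition3p2
    {Ω : Type*} [MeasurableSpace Ω] (P : Measure Ω) [IsProbabilityMeasure P]
    -- two independent Brownian motions and the mixed one
    (B B' : ℝ≥0 → Ω → ℝ) (hB : IsBrownianReal B P) (hB' : IsBrownianReal B' P)
    (hBB' : IndepFun (fun ω t => B t ω) (fun ω t => B' t ω) P)
    (α α' : ℝ) (hα : α ≠ 0 ∨ α' ≠ 0)
    -- a continuous Volterra process driven by `B`
    (X : Ω → C(ℝ≥0, ℝ)) (hX : IsVolterraProcess (fun t ω => X ω t) B P)
    -- the conditioning functionals `G i = ∫₀ᵀ g i dW`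
    (T : ℝ≥0) (hT : 0 < T) (n : ℕ)
    (g : Fin n → Lp ℝ 2 ((volume : Measure ℝ).restrict (Icc (0 : ℝ) T)))
    (hg : LinearIndependent ℝ g)
    (G : Fin n → Ω → ℝ)
    (hG : ∀ i, IsWienerIntegral (mixedBM α α' B B') P T (g i) (G i))
    -- the conditional law of `X` given `G = x`
    (κ : Kernel (Fin n → ℝ) C(ℝ≥0, ℝ)) (hκ : IsConditionedLaw X G P κ)
    -- the infinitesimal function
    (γ : ℝ≥0 → ℝ) (hγ_pos : ∀ ε, 0 < ε → 0 < γ ε) (hγ : Tendsto γ (𝓝[>] 0) (𝓝 0))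
    -- the bound on the variances of the increments of `X`
    (hVar : ∃ M > (0 : ℝ), ∃ τ > (0 : ℝ), ∀ᶠ ε in 𝓝[>] (0 : ℝ≥0),
      ∀ s t : unitInterval, s ≠ t →
        Var[fun ω => X ω (zoomTime T ε t) - X ω (zoomTime T ε s); P]
          / (γ ε ^ 2 * |(t : ℝ) - s| ^ (2 * τ)) ≤ M)
    -- the bound on the covariances of the increments of `X` with the functionals
    (hCov : ∃ M > (0 : ℝ), ∃ τ > (0 : ℝ), ∀ᶠ ε in 𝓝[>] (0 : ℝ≥0), ∀ i : Fin n,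
      ∀ s t : unitInterval, s ≠ t →
        |cov[fun ω => X ω (zoomTime T ε t) - X ω (zoomTime T ε s), G i; P]|
          / (γ ε * |(t : ℝ) - s| ^ τ) ≤ M) :
    ∀ x : Fin n → ℝ,
      IsExponentiallyTight (κ x) (fun ε t f => centeredIncrement (κ x) T ε t f)
        (fun ε => γ ε ^ 2) := by

  intro x
  obtain ⟨M, hM, τ, hτ, hVar⟩ := hVar
  obtain ⟨M', hM', τ', hτ', hCov⟩ := hCov
  have := hκ.markov
  set A : Matrix (Fin n) (Fin n) ℝ := (Matrix.of fun i j => cov[G i, G j; P])⁻¹ with hA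
  choose v hv hlaw using exists_map_increment_eq_gaussianReal hB hB' hBB' hα hX hg hG hκ
  have hcont : ∀ s t : ℝ≥0, Continuous fun f : C(ℝ≥0, ℝ) => f t - f s := fun s t => by fun_prop
  have hint : ∀ s t : ℝ≥0, Integrable (fun f : C(ℝ≥0, ℝ) => f t - f s) (κ x) := by
    intro s t
    have h : Integrable id ((κ x).map fun f : C(ℝ≥0, ℝ) => f t - f s) := by
      rw [hlaw s t x]
      exact IsGaussian.integrable_id
    exact h.comp_measurable (hcont s t).measurable
  have hmean : ∀ s t : ℝ≥0, ∫ f, (f t - f s) ∂(κ x) =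
      (A.mulVec fun i => cov[fun ω => X ω t - X ω s, G i; P]) ⬝ᵥ x := by
    intro s t
    have h : ∫ z, z ∂((κ x).map fun f : C(ℝ≥0, ℝ) => f t - f s) = _ :=
      (congrArg (fun μ => ∫ z, z ∂μ) (hlaw s t x)).trans integral_id_gaussianReal
    rwa [integral_map (hcont s t).aemeasurable (by fun_prop)] at h
  have hmean_sub : ∀ (ε : ℝ≥0) (s t : unitInterval),
      (∫ f, (f (zoomTime T ε t) - f T) ∂(κ x)) - ∫ f, (f (zoomTime T ε s) - f T) ∂(κ x) =
        ∫ f, (f (zoomTime T ε t) - f (zoomTime T ε s)) ∂(κ x) := by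
    intro ε s t
    rw [← integral_sub (hint _ _) (hint _ _)]
    simp only [sub_sub_sub_cancel_right]
  have hpos : ∀ᶠ ε in 𝓝[>] (0 : ℝ≥0), 0 < γ ε := by
    filter_upwards [self_mem_nhdsWithin] with ε hε using hγ_pos ε hε
  have hdist : ∀ {s t : unitInterval}, s ≠ t → 0 < |(t : ℝ) - s| := fun hst =>
    abs_pos.2 (sub_ne_zero.2 fun h => hst (Subtype.ext h.symm))
  refine isExponentiallyTight_of_gaussian_increments hγ_pos hγ hM hτ
    (fun ε f => centeredIncrement_zero _ T ε f) ?_ ?_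
  -- Continuity of the paths: `f` is continuous already, and the covariance bound makes the mean
  -- Hölder continuous with exponent `τ'`.
  · filter_upwards [hCov, hpos] with ε hCov hε f
    refine ((f.continuous.comp (continuous_zoomTime T ε)).sub continuous_const).sub ?_
    refine continuous_of_abs_sub_le_rpow (C := (∑ i, ∑ j, |A i j| * |x i|) * (M' * γ ε)) hτ'
      fun s t hst => ?_
    rw [hmean_sub, hmean, mul_assoc]
    refine abs_mulVec_dotProduct_le _ _ _ fun i => ?_
    have h := (div_le_iff₀ (mul_pos hε (Real.rpow_pos_of_pos (hdist hst) τ'))).1 (hCov i s t hst)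
    rwa [← mul_assoc] at h
  -- Centering cancels the conditional mean exactly, leaving the conditional variance, at most the
  -- unconditional one.
  · filter_upwards [hVar, hpos] with ε hVar hε s t hst
    refine ⟨v (zoomTime T ε s) (zoomTime T ε t), ?_, (hv _ _).trans ?_⟩
    · have heq : (fun f => centeredIncrement (κ x) T ε t f - centeredIncrement (κ x) T ε s f) =
          (fun z => z - ∫ f, (f (zoomTime T ε t) - f (zoomTime T ε s)) ∂(κ x)) ∘
            fun f : C(ℝ≥0, ℝ) => f (zoomTime T ε t) - f (zoomTime T ε s) := by
        ext f
        simp only [centeredIncrement, Function.comp_apply, ← hmean_sub]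
        ring
      rw [heq, ← Measure.map_map (by fun_prop) (hcont _ _).measurable, hlaw,
        gaussianReal_map_sub_const, hmean, sub_self]
    · have h := (div_le_iff₀ (mul_pos (pow_pos hε 2)
        (Real.rpow_pos_of_pos (hdist hst) (2 * τ)))).1 (hVar s t hst)
      rwa [← mul_assoc] at h
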